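/- Work over $\mathbb{C}$. Let $S \to (\mathbb{P}^2)^\vee$ be the tautological rank-two bundle on the space of lines in $\mathbb{P}^2 = \mathbb{P}(V)$, $V=\mathbb{C}^3$, and let $X = \mathbb{P}(\mathrm{Sym}^2 S^\vee) \xrightarrow{\pi} (\mathbb{P}^2)^\vee$, so that a point of $X$ is a pair $(L,Z)$ of a line $L \subset \mathbb{P}^2$ and a degree-two subscheme $Z \subset L$. Squaring the inclusion $\mathcal{O}_X(-1) \subset \pi^*\mathrm{Sym}^2 S^\vee$ gives $\mathcal{O}_X(-2) \subset \pi^*\mathrm{Sym}^4 S^\vee$; put $E = \pi^*\mathrm{Sym}^4 S^\vee/\mathcal{O}_X(-2)$. For a plane quartic curve $C=\{f=0\}$ ($f \ne 0$ a quartic form) let $\mathrm{Aut}(C) \le \mathrm{PGL}_3(\mathbb{C})$ be the group of projective transformations mapping the subscheme $C$ to itself, and let $\sigma_C$ be the section $(L,Z) \mapsto [f|_L]$ of $E$. A linearized $G$-action on $E$ (an action on the total space, over the action on $X$ and linear on the fibres) is called natural if each $g \in G$ acts by $[F] \mapsto [F\circ A^{-1}]$, from the fibre at $(L,Z)$ to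 the fibre at $(gL,gZ)$, for some representative $A \in \mathrm{GL}_3(\mathbb{C})$ of $g$. **Theorem.** Let $G \le \mathrm{PGL}_3(\mathbb{C})$ be contained in $\mathrm{Aut}(C_0)$ for some smooth plane quartic $C_0$. Then $E \to X$ is a holomorphic vector bundle of rank four, and it is $G$-equivariant: it has a continuous natural linearized $G$-action $\rho$. Let $C$ be any plane quartic with $G \le \mathrm{Aut}(C)$. Then: 1. $\sigma_C$ is a continuous, holomorphic section of $E$, and there is a character $\chi : G \to \mathbb{C}^\times$ such that $\sigma_C$ is $G$-equivariant for the twisted action $\chi\otimes\rho$, which is again natural and continuous. 2. If $C$ contains no line (in particular, if $C$ is smooth), then $(L,Z) \mapsto L$ is a bijection from the zeros of $\sigma_C$ onto the bitangents of $C$, that is, the lines that are tangent to $C$ at two distinct points or have contact of order four with $C$ at one point; and for a zero $(L,Z)$, the points of $Z$ are exactly the points at which $L$ has contact of order at least two with $C$. -/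

import Mathlib

open scoped MatrixGroups LinearAlgebra.Projectivization
open Bundle

noncomputable section

namespace QuarticBitangents

/-! ### Symmetric powers of dual spaces, as spaces of homogeneous polynomial functions -/

/-- The symmetric power `Sym^d (M^∨)`, realised as the space of homogeneous polynomial functions
of degree `d` on the complex vector space `M`: the span of the `d`-fold products of linear
functionals, in the algebra of all functions on `M`. -/
def symPow (M : Type) [AddCommGroup M] [Module ℂ M] (d : ℕ) : Submodule ℂ (M → ℂ) :=
  (LinearMap.range (LinearMap.ltoFun ℂ M ℂ ℂ)) ^ d

section Pullback

variable {M N : Type} [AddCommGroup M] [Module ℂ M] [AddCommGroup N] [Module ℂ N]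

/-- Pullback of functions along a linear map. -/
def funPullback (e : M →ₗ[ℂ] N) : (N → ℂ) →ₐ[ℂ] (M → ℂ) where
  toFun φ := fun v => φ (e v)
  map_one' := rfl
  map_mul' _ _ := rfl
  map_zero' := rfl
  map_add' _ _ := rfl
  commutes' _ := rfl

@[simp]
theorem funPullback_apply (e : M →ₗ[ℂ] N) (φ : N → ℂ) (v : M) : funPullback e φ v = φ (e v) := rfl

theorem funPullback_mem (e : M →ₗ[ℂ] N) (d : ℕ) {φ : N → ℂ} (hφ : φ ∈ symPow N d) :
    funPullback e φ ∈ symPow M d := by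
  have h1 : Submodule.map (funPullback e).toLinearMap (LinearMap.range (LinearMap.ltoFun ℂ N ℂ ℂ))
      ≤ LinearMap.range (LinearMap.ltoFun ℂ M ℂ ℂ) := by
    rintro _ ⟨_, ⟨ℓ, rfl⟩, rfl⟩
    exact ⟨ℓ ∘ₗ e, rfl⟩
  have h2 : funPullback e φ ∈ Submodule.map (funPullback e).toLinearMap (symPow N d) :=
    ⟨φ, hφ, rfl⟩
  rw [symPow, Submodule.map_pow] at h2
  exact pow_le_pow_left' h1 d h2

/-- The map `Sym^d (N^∨) → Sym^d (M^∨)` induced by a linear map `M → N`. -/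
def symPullback (e : M →ₗ[ℂ] N) (d : ℕ) : symPow N d →ₗ[ℂ] symPow M d :=
  (funPullback e).toLinearMap.restrict (fun _ h => funPullback_mem e d h)

@[simp]
theorem symPullback_coe (e : M →ₗ[ℂ] N) (d : ℕ) (φ : symPow N d) (v : M) :
    (symPullback e d φ : M → ℂ) v = (φ : N → ℂ) (e v) := rfl

theorem symPullback_injective {e : M →ₗ[ℂ] N} (he : Function.Surjective e) (d : ℕ) :
    Function.Injective (symPullback e d) := by
  intro φ ψ h
  ext v
  obtain ⟨w, rfl⟩ := he v
  have := congrFun (congrArg Subtype.val h) w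
  simpa using this

end Pullback

/-! ### The space `X = ℙ(Sym² S^∨)` over the dual projective plane -/

/-- The three-dimensional vector space whose projectivization is `ℙ²`. -/
abbrev V : Type := Fin 3 → ℂ

/-- The dual projective plane: lines in `ℙ²`, that is, two-dimensional linear subspaces of `V`.
The fibre of the tautological bundle `S` over `L` is `L` itself. -/
abbrev DualPlane : Type := {L : Submodule ℂ V // Module.finrank ℂ L = 2}

/-- `X = ℙ(Sym² S^∨)`. A point is a line `L` with a one-dimensional subspace of `Sym² L^∨`, i.e.
a degree two subscheme `Z` of `L`, given by the line of its equations. -/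
structure X : Type where
  line : DualPlane
  scheme : ℙ ℂ (symPow line.1 2)

/-- The fibre of `O_X(-1) ⊆ π^* Sym² S^∨`, as a space of functions on `L`. -/
def tautFibre (x : X) : Submodule ℂ (x.line.1 → ℂ) :=
  x.scheme.submodule.map (symPow x.line.1 2).subtype

theorem tautFibre_le (x : X) : tautFibre x ≤ symPow x.line.1 2 := by
  rintro _ ⟨φ, -, rfl⟩
  exact φ.2

/-- The image of the fibre of `O_X(-2)` under `O_X(-2) → Sym² S^∨ ⊗ Sym² S^∨ → Sym⁴ S^∨`:
the span of the products of two elements of `O_X(-1)`. -/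
def tautSqFibre (x : X) : Submodule ℂ (symPow x.line.1 4) :=
  ((tautFibre x) ^ 2).comap (symPow x.line.1 4).subtype

theorem tautFibre_sq_le (x : X) : (tautFibre x) ^ 2 ≤ symPow x.line.1 4 := by
  refine (pow_le_pow_left' (tautFibre_le x) 2).trans (le_of_eq ?_)
  rw [symPow, symPow, ← pow_mul]

/-- The fibres of the bundle `E = Sym⁴ S^∨ / O_X(-2)` over `X`. -/
abbrev E (x : X) : Type := symPow x.line.1 4 ⧸ tautSqFibre x

/-- The model fibre of the rank four bundle `E`. -/
abbrev ModelFibre : Type := Fin 4 → ℂ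

/-! ### Topology and holomorphic structure

`X` and the total space of `E` are quotients, by holomorphic submersions, of open subsets of
complex coordinate spaces: a nonzero linear form `a` on `V`, a quadratic form `q` on `V` that does
not vanish identically on the line `a = 0`, and a quartic form `F` on `V` are sent to the line
`L = {a = 0}`, the subscheme `Z = {q = 0}` of `L`, and the class of `F` restricted to `L`. -/

/-- Coefficients of (not necessarily symmetric) tensors of degree `d` on `V`. -/
abbrev Coef (d : ℕ) : Type := (Fin d → Fin 3) → ℂ

theorem prod_coord_mem (d : ℕ) (i : Fin d → Fin 3) :
    (fun v : V => ∏ k, v (i k)) ∈ symPow V d := by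
  induction d with
  | zero =>
    simp only [Finset.univ_eq_empty, Finset.prod_empty, symPow, pow_zero]
    exact Submodule.one_le.1 le_rfl
  | succ d ih =>
    have h := Submodule.mul_mem_mul (ih (fun k => i k.castSucc))
      (show (fun v : V => v (i (Fin.last d))) ∈ LinearMap.range (LinearMap.ltoFun ℂ V ℂ ℂ) from
        ⟨LinearMap.proj (i (Fin.last d)), rfl⟩)
    rw [symPow, ← pow_succ] at h
    rw [symPow]
    convert h using 1
    funext v
    simp [Fin.prod_univ_castSucc]

/-- The homogeneous form of degree `d` on `V` with the given coefficients. -/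
def coefForm (d : ℕ) : Coef d →ₗ[ℂ] symPow V d :=
  ∑ i : Fin d → Fin 3,
    (LinearMap.proj i : Coef d →ₗ[ℂ] ℂ).smulRight ⟨fun v : V => ∏ k, v (i k), prod_coord_mem d i⟩

theorem coefForm_apply (d : ℕ) (c : Coef d) (v : V) :
    (coefForm d c : V → ℂ) v = ∑ i : Fin d → Fin 3, c i * ∏ k, v (i k) := by
  simp [coefForm]

/-- Restriction of forms on `V` to a subspace. -/
def symRestrict (L : Submodule ℂ V) (d : ℕ) : symPow V d →ₗ[ℂ] symPow L d :=
  symPullback L.subtype d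

/-- The linear functional on `V` with coefficient vector `a`. -/
def linForm (a : V) : V →ₗ[ℂ] ℂ := ∑ i, a i • (LinearMap.proj i : V →ₗ[ℂ] ℂ)

theorem linForm_apply (a v : V) : linForm a v = ∑ i, a i * v i := by
  simp [linForm]

theorem finrank_ker_linForm {a : V} (ha : a ≠ 0) :
    Module.finrank ℂ (LinearMap.ker (linForm a)) = 2 := by
  have hne : linForm a ≠ 0 := by
    intro h
    apply ha
    funext i
    have := LinearMap.congr_fun h (Pi.single i 1)
    simpa [linForm_apply, Pi.single_apply] using this
  have hs : LinearMap.range (linForm a) = ⊤ :=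
    LinearMap.range_eq_top.2 (LinearMap.surjective hne)
  have h := LinearMap.finrank_range_add_finrank_ker (linForm a)
  rw [hs, finrank_top, Module.finrank_self, Module.finrank_fin_fun] at h
  omega

/-- The parameters `(a, q)`. -/
def paramSet : Set (V × Coef 2) :=
  {p | p.1 ≠ 0 ∧ symRestrict (LinearMap.ker (linForm p.1)) 2 (coefForm 2 p.2) ≠ 0}

/-- The map `(a, q) ↦ (L, Z)`. -/
def mkX (p : paramSet) : X :=
  ⟨⟨LinearMap.ker (linForm p.1.1), finrank_ker_linForm p.2.1⟩,
    Projectivization.mk ℂ (symRestrict (LinearMap.ker (linForm p.1.1)) 2 (coefForm 2 p.1.2)) p.2.2⟩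

/-- The map `(a, q, F) ↦ ((L, Z), [F|_L])`. -/
def mkE (y : paramSet × Coef 4) : TotalSpace ModelFibre E :=
  ⟨mkX y.1, Submodule.Quotient.mk (symRestrict (mkX y.1).line.1 4 (coefForm 4 y.2))⟩

instance : TopologicalSpace X := TopologicalSpace.coinduced mkX inferInstance

instance : TopologicalSpace (TotalSpace ModelFibre E) :=
  TopologicalSpace.coinduced mkE inferInstance

/-- A local trivialization of `E` is holomorphic if, in the parameters `(a, q, F)`, it is given by
a holomorphic function. -/
def IsHolomorphicTrivialization (e : Trivialization ModelFibre (π ModelFibre E)) : Prop :=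
  ∃ Φ : (V × Coef 2) × Coef 4 → ModelFibre,
    DifferentiableOn ℂ Φ {y | ∃ h : y.1 ∈ paramSet, mkX ⟨y.1, h⟩ ∈ e.baseSet} ∧
    ∀ (p : paramSet) (F : Coef 4), mkX p ∈ e.baseSet → Φ (p.1, F) = (e (mkE (p, F))).2

/-- A section of `E` is holomorphic in a local trivialization if its coordinates there are
holomorphic functions of the parameters `(a, q)`. -/
def IsHolomorphicSectionIn (e : Trivialization ModelFibre (π ModelFibre E)) (s : ∀ x : X, E x) :
    Prop :=
  ∃ Ψ : V × Coef 2 → ModelFibre,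
    DifferentiableOn ℂ Ψ {y | ∃ h : y ∈ paramSet, mkX ⟨y, h⟩ ∈ e.baseSet} ∧
    ∀ p : paramSet, mkX p ∈ e.baseSet → Ψ p.1 = (e ⟨mkX p, s (mkX p)⟩).2

/-! ### The action of `PGL₃` on `X` -/

/-- The linear automorphism of `V` given by `A ∈ GL₃`. -/
def glEquiv : GL (Fin 3) ℂ →* (V ≃ₗ[ℂ] V) :=
  (LinearMap.GeneralLinearGroup.generalLinearEquiv ℂ V).toMonoidHom.comp
    (Matrix.GeneralLinearGroup.toLin (n := Fin 3) (R := ℂ)).toMonoidHom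

theorem glEquiv_apply (A : GL (Fin 3) ℂ) (v : V) :
    glEquiv A v = (A : Matrix (Fin 3) (Fin 3) ℂ).mulVec v := rfl

theorem glEquiv_scalar (u : ℂˣ) (v : V) :
    glEquiv (Matrix.GeneralLinearGroup.scalar (Fin 3) u) v = (u : ℂ) • v := by
  simp [glEquiv_apply]

/-- The line `A L`. -/
def moveLine (A : GL (Fin 3) ℂ) (L : DualPlane) : DualPlane :=
  ⟨L.1.map (glEquiv A).toLinearMap, by
    rw [LinearEquiv.finrank_map_eq (glEquiv A) L.1]
    exact L.2⟩

theorem moveLine_one (L : DualPlane) : moveLine 1 L = L := by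
  apply Subtype.ext
  simp only [moveLine, map_one]
  exact Submodule.map_id L.1

theorem moveLine_mul (A B : GL (Fin 3) ℂ) (L : DualPlane) :
    moveLine (A * B) L = moveLine A (moveLine B L) := by
  apply Subtype.ext
  simp only [moveLine, map_mul]
  exact Submodule.map_comp (glEquiv B).toLinearMap (glEquiv A).toLinearMap L.1

/-- The map `A L → L`, `v ↦ A⁻¹ v`. -/
def transportBack (A : GL (Fin 3) ℂ) (L : DualPlane) : (moveLine A L).1 →ₗ[ℂ] L.1 :=
  ((glEquiv A).symm.toLinearMap).restrict (by
    rintro _ ⟨w, hw, rfl⟩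
    simpa using hw)

theorem transportBack_coe (A : GL (Fin 3) ℂ) (L : DualPlane) (v : (moveLine A L).1) :
    (transportBack A L v : V) = (glEquiv A).symm v := rfl

theorem transportBack_surjective (A : GL (Fin 3) ℂ) (L : DualPlane) :
    Function.Surjective (transportBack A L) := by
  intro v
  refine ⟨⟨glEquiv A v, ⟨v, v.2, rfl⟩⟩, Subtype.ext ?_⟩
  simp [transportBack_coe]

/-- `A ∈ GL₃` sends `(L, Z)` to `(A L, A Z)`: the equations of `A Z` on `A L` are the `q ∘ A⁻¹`
for the equations `q` of `Z` on `L`. -/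
def moveX (A : GL (Fin 3) ℂ) (x : X) : X :=
  ⟨moveLine A x.line, x.scheme.map (symPullback (transportBack A x.line) 2)
    (symPullback_injective (transportBack_surjective A x.line) 2)⟩

theorem X_ext {L L' : DualPlane} (h : L = L') (q : symPow L.1 2) (hq : q ≠ 0)
    (q' : symPow L'.1 2) (hq' : q' ≠ 0) (c : ℂˣ)
    (hqq : ∀ (v : V) (hv : v ∈ L.1) (hv' : v ∈ L'.1),
      (q : L.1 → ℂ) ⟨v, hv⟩ = c * (q' : L'.1 → ℂ) ⟨v, hv'⟩) :
    (⟨L, Projectivization.mk ℂ q hq⟩ : X) = ⟨L', Projectivization.mk ℂ q' hq'⟩ := by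
  obtain rfl := h
  congr 1
  rw [Projectivization.mk_eq_mk_iff]
  refine ⟨c, ?_⟩
  ext v
  exact (hqq v.1 v.2 v.2).symm

theorem moveX_mk (A : GL (Fin 3) ℂ) (L : DualPlane) (q : symPow L.1 2) (hq : q ≠ 0) :
    moveX A ⟨L, Projectivization.mk ℂ q hq⟩ =
      ⟨moveLine A L, Projectivization.mk ℂ (symPullback (transportBack A L) 2 q)
        ((map_ne_zero_iff _ (symPullback_injective (transportBack_surjective A L) 2)).2 hq)⟩ := rfl

instance : MulAction (GL (Fin 3) ℂ) X where
  smul := moveX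
  one_smul x := by
    obtain ⟨L, Z⟩ := x
    induction Z using Projectivization.ind with
    | h q hq =>
      change moveX 1 _ = _
      rw [moveX_mk]
      refine X_ext (moveLine_one L) _ _ _ _ 1 fun v hv hv' => ?_
      rw [Units.val_one, one_mul, symPullback_coe]
      refine congrArg (q : L.1 → ℂ) (Subtype.ext ?_)
      rw [transportBack_coe, map_one]
      rfl
  mul_smul A B x := by
    obtain ⟨L, Z⟩ := x
    induction Z using Projectivization.ind with
    | h q hq =>
      change moveX (A * B) _ = moveX A (moveX B _)
      rw [moveX_mk, moveX_mk, moveX_mk]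
      refine X_ext (moveLine_mul A B L) _ _ _ _ 1 fun v hv hv' => ?_
      rw [Units.val_one, one_mul, symPullback_coe, symPullback_coe, symPullback_coe]
      refine congrArg (q : L.1 → ℂ) (Subtype.ext ?_)
      rw [transportBack_coe, transportBack_coe, transportBack_coe, map_mul]
      rfl

theorem symPow_smul {M : Type} [AddCommGroup M] [Module ℂ M] (d : ℕ) {φ : M → ℂ}
    (hφ : φ ∈ symPow M d) (c : ℂ) (v : M) : φ (c • v) = c ^ d * φ v := by
  rw [symPow] at hφ
  induction d generalizing φ with
  | zero =>
    rw [pow_zero, Submodule.mem_one] at hφ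
    obtain ⟨y, rfl⟩ := hφ
    simp [Pi.algebraMap_apply]
  | succ d ih =>
    rw [pow_succ] at hφ
    induction hφ using Submodule.mul_induction_on' with
    | mem_mul_mem m hm n hn =>
      obtain ⟨ℓ, rfl⟩ := hn
      have h := ih hm
      simp only [Pi.mul_apply, h, LinearMap.ltoFun_apply, map_smul, smul_eq_mul]
      ring
    | add x hx y hy h1 h2 =>
      simp only [Pi.add_apply, h1, h2]
      ring

theorem moveLine_scalar (u : ℂˣ) (L : DualPlane) :
    moveLine (Matrix.GeneralLinearGroup.scalar (Fin 3) u) L = L := by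
  apply Subtype.ext
  ext v
  constructor
  · rintro ⟨w, hw, rfl⟩
    have : glEquiv (Matrix.GeneralLinearGroup.scalar (Fin 3) u) w ∈ L.1 := by
      rw [glEquiv_scalar]
      exact L.1.smul_mem _ hw
    exact this
  · intro hv
    refine ⟨(u : ℂ)⁻¹ • v, L.1.smul_mem _ hv, ?_⟩
    change glEquiv _ _ = v
    rw [glEquiv_scalar, smul_smul, mul_inv_cancel₀ u.ne_zero, one_smul]

theorem scalar_smul_X (u : ℂˣ) (x : X) :
    Matrix.GeneralLinearGroup.scalar (Fin 3) u • x = x := by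
  obtain ⟨L, Z⟩ := x
  induction Z using Projectivization.ind with
  | h q hq =>
    change moveX _ _ = _
    rw [moveX_mk]
    refine X_ext (moveLine_scalar u L) _ _ _ _ (u⁻¹ ^ 2) fun v hv hv' => ?_
    rw [Units.val_pow_eq_pow_val, ← symPow_smul 2 q.2, symPullback_coe]
    refine congrArg (q : L.1 → ℂ) (Subtype.ext ?_)
    rw [transportBack_coe, LinearEquiv.symm_apply_eq, glEquiv_scalar]
    change v = (u : ℂ) • ((u⁻¹ : ℂˣ) : ℂ) • v
    rw [smul_smul, Units.mul_inv, one_smul]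

/-- The action of `PGL₃` on `X` through representatives in `GL₃`. -/
instance : MulAction PGL(3, ℂ) X := Matrix.ProjGenLinGroup.mulActionOfGL scalar_smul_X

/-! ### Equivariant vector bundles -/

/-- An action of a group `Γ` on the total space of `E → B` over a given action on the base `B`, by
maps that are linear on the fibres. -/
structure LinearizedAction (Γ : Type) [Group Γ] {B : Type} [MulAction Γ B] (F : Type)
    (E : B → Type) [∀ b, AddCommGroup (E b)] [∀ b, Module ℂ (E b)] where
  /-- the action on the fibres -/
  act : ∀ (g : Γ) (b : B), E b →ₗ[ℂ] E (g • b)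
  one_act : ∀ (b : B) (v : E b),
    (⟨(1 : Γ) • b, act 1 b v⟩ : TotalSpace F E) = ⟨b, v⟩
  mul_act : ∀ (g h : Γ) (b : B) (v : E b),
    (⟨(g * h) • b, act (g * h) b v⟩ : TotalSpace F E) = ⟨g • h • b, act g (h • b) (act h b v)⟩

namespace LinearizedAction

section General

variable {Γ : Type} [Group Γ] {B : Type} [MulAction Γ B] {F : Type}
  {E : B → Type} [∀ b, AddCommGroup (E b)] [∀ b, Module ℂ (E b)]

/-- The map of total spaces given by a group element. -/
def totalMap (ρ : LinearizedAction Γ F E) (g : Γ) (v : TotalSpace F E) : TotalSpace F E :=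
  ⟨g • v.1, ρ.act g v.1 v.2⟩

/-- The group acts by continuous maps, hence by homeomorphisms, on the base and on the total
space. -/
def IsContinuous [TopologicalSpace B] [TopologicalSpace (TotalSpace F E)]
    (ρ : LinearizedAction Γ F E) : Prop :=
  ∀ g : Γ, Continuous (fun b : B => g • b) ∧ Continuous (ρ.totalMap g)

/-- A section is equivariant if `g (s b) = s (g b)`. -/
def IsEquivariantSection (ρ : LinearizedAction Γ F E) (s : ∀ b, E b) : Prop :=
  ∀ (g : Γ) (b : B), ρ.act g b (s b) = s (g • b)

theorem mk_smul_eq {b b' : B} {v : E b} {v' : E b'} (c : ℂ)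
    (h : (⟨b, v⟩ : TotalSpace F E) = ⟨b', v'⟩) :
    (⟨b, c • v⟩ : TotalSpace F E) = ⟨b', c • v'⟩ := by
  obtain rfl : b = b' := congrArg TotalSpace.proj h
  obtain rfl : v = v' := TotalSpace.mk_injective b h
  rfl

/-- The twist of a linearized action by a character of the group: the same action on the base, with
the action of `g` on the fibres multiplied by `χ g`. -/
def twist (ρ : LinearizedAction Γ F E) (χ : Γ →* ℂˣ) : LinearizedAction Γ F E where
  act g b := (χ g : ℂ) • ρ.act g b
  one_act b v := by
    simpa using ρ.one_act b v
  mul_act g h b v := by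
    have := mk_smul_eq ((χ g : ℂ) * (χ h : ℂ)) (ρ.mul_act g h b v)
    simp only [LinearMap.smul_apply, map_smul, smul_smul, map_mul, Units.val_mul]
    rw [mul_comm (χ h : ℂ)]
    exact this

end General

end LinearizedAction

theorem transportBack_tautFibre (A : GL (Fin 3) ℂ) (x : X) :
    (tautFibre x).map (funPullback (transportBack A x.line)).toLinearMap = tautFibre (A • x) := by
  obtain ⟨L, Z⟩ := x
  induction Z using Projectivization.ind with
  | h q hq =>
    change _ = tautFibre ⟨moveLine A L, Projectivization.mk ℂ (symPullback (transportBack A L) 2 q)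
        ((map_ne_zero_iff _ (symPullback_injective (transportBack_surjective A L) 2)).2 hq)⟩
    simp only [tautFibre, Projectivization.submodule_mk, Submodule.map_span, Set.image_singleton]
    rfl

/-- The map on the fibres of `E` induced by the action of `A ∈ GL₃` on the tautological bundle:
the class of the form `F` on `L` is sent to the class of the form `F ∘ A⁻¹` on `A L`. -/
def naturalMap (A : GL (Fin 3) ℂ) (x : X) : E x →ₗ[ℂ] E (A • x) :=
  Submodule.mapQ (tautSqFibre x) (tautSqFibre (A • x)) (symPullback (transportBack A x.line) 4) (by
    intro φ hφ
    have h : funPullback (transportBack A x.line) φ ∈ ((tautFibre x) ^ 2).map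
        (funPullback (transportBack A x.line)).toLinearMap := ⟨_, hφ, rfl⟩
    rw [Submodule.map_pow, transportBack_tautFibre] at h
    exact h)

/-- A linearized action on `E` of a group of projective transformations is natural if each group
element acts through the action on the tautological bundle of one of its representatives in
`GL₃`. -/
def IsNatural {G : Subgroup PGL(3, ℂ)} (ρ : LinearizedAction G ModelFibre E) : Prop :=
  ∀ g : G, ∃ A : GL (Fin 3) ℂ, Matrix.ProjGenLinGroup.mk A = (g : PGL(3, ℂ)) ∧
    ∀ (x : X) (v : E x),
      (⟨g • x, ρ.act g x v⟩ : TotalSpace ModelFibre E) = ⟨A • x, naturalMap A x v⟩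

/-! ### Plane quartics -/

/-- A plane quartic curve, given by its equation. It may be singular. -/
structure PlaneQuartic where
  form : MvPolynomial (Fin 3) ℂ
  homogeneous : form.IsHomogeneous 4
  ne_zero : form ≠ 0

/-- Linear substitution, `f ↦ f ∘ A`. -/
def linSubst (A : GL (Fin 3) ℂ) : MvPolynomial (Fin 3) ℂ →ₐ[ℂ] MvPolynomial (Fin 3) ℂ :=
  MvPolynomial.aeval (fun i => ∑ j, MvPolynomial.C (A i j) * MvPolynomial.X j)

theorem linSubst_one : linSubst 1 = AlgHom.id ℂ _ := by
  apply MvPolynomial.algHom_ext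
  intro i
  simp [linSubst, Matrix.one_apply]

theorem linSubst_mul (A B : GL (Fin 3) ℂ) :
    linSubst (A * B) = (linSubst B).comp (linSubst A) := by
  apply MvPolynomial.algHom_ext
  intro i
  simp only [linSubst, MvPolynomial.aeval_X, AlgHom.comp_apply, map_sum, map_mul,
    Units.val_mul, Matrix.mul_apply, MvPolynomial.algHom_C, MvPolynomial.algebraMap_eq,
    Finset.sum_mul, Finset.mul_sum]
  rw [Finset.sum_comm]
  simp [mul_assoc]

namespace PlaneQuartic

variable (C : PlaneQuartic)

/-- `C` is smooth: the gradient of its equation does not vanish at any point of `C`. -/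
def IsSmooth : Prop :=
  ∀ v : V, v ≠ 0 → MvPolynomial.eval v C.form = 0 →
    ∃ i, MvPolynomial.eval v (MvPolynomial.pderiv i C.form) ≠ 0

/-- The elements of `GL₃` that map the subscheme `C` of the projective plane to itself, i.e. that
preserve its homogeneous ideal. -/
def linStabilizer : Subgroup (GL (Fin 3) ℂ) where
  carrier := {A | Ideal.map (linSubst A) (Ideal.span {C.form}) = Ideal.span {C.form}}
  one_mem' := by
    simp [linSubst_one]
  mul_mem' := by
    intro A B hA hB
    simp only [Set.mem_ofPred_eq] at *
    rw [linSubst_mul, ← Ideal.map_mapₐ, hA, hB]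
  inv_mem' := by
    intro A hA
    simp only [Set.mem_ofPred_eq] at *
    conv_lhs => rw [← hA]
    rw [Ideal.map_mapₐ, ← linSubst_mul, mul_inv_cancel, linSubst_one]
    simp

/-- The group `Aut(C)` of projective transformations of the plane that preserve `C`. For smooth
`C` this is the full automorphism group of the curve, as all of its automorphisms are induced by
projective transformations. -/
def aut : Subgroup PGL(3, ℂ) := C.linStabilizer.map Matrix.ProjGenLinGroup.mk

theorem eval_form_mem : (fun v : V => MvPolynomial.eval v C.form) ∈ symPow V 4 := by
  have key : (fun v : V => MvPolynomial.eval v C.form) =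
      ∑ m ∈ C.form.support, C.form.coeff m • (fun v : V => ∏ i, v i ^ m i) := by
    funext v
    rw [MvPolynomial.eval_eq']
    simp [Finset.sum_apply]
  rw [key]
  refine Submodule.sum_mem _ fun m hm => Submodule.smul_mem _ _ ?_
  have hdeg : ∑ i, m i = 4 := by
    have h := C.homogeneous (MvPolynomial.mem_support_iff.1 hm)
    rw [Finsupp.weight_apply, Finsupp.sum_fintype _ _ (by simp)] at h
    simpa using h
  have hcoord (i : Fin 3) : (fun v : V => v i ^ m i) ∈
      (LinearMap.range (LinearMap.ltoFun ℂ V ℂ ℂ)) ^ m i :=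
    Submodule.pow_mem_pow _ (show (fun v : V => v i) ∈ LinearMap.range (LinearMap.ltoFun ℂ V ℂ ℂ)
      from ⟨LinearMap.proj i, rfl⟩) (m i)
  have h := Submodule.mul_mem_mul (Submodule.mul_mem_mul (hcoord 0) (hcoord 1)) (hcoord 2)
  rw [← pow_add, ← pow_add] at h
  rw [symPow, ← hdeg, Fin.sum_univ_three]
  convert h using 1
  funext v
  simp [Fin.prod_univ_three]

/-- The equation of `C`, as an element of `Sym⁴ V^∨`. -/
def toSym : symPow V 4 := ⟨fun v => MvPolynomial.eval v C.form, C.eval_form_mem⟩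

/-- The section of `E` induced by `C`: its value at `(L, Z)` is the class of the restriction of the
equation of `C` to `L`. -/
def inducedSection (x : X) : E x := Submodule.Quotient.mk (symRestrict x.line.1 4 C.toSym)

/-- The line `L` and the curve `C` meet at the point of `ℙ²` spanned by `p` with intersection
multiplicity at least `k`: the equation of `C` vanishes to order at least `k` at `p` along `L`. -/
def ContactAtLeast (L : DualPlane) (p : V) (k : ℕ) : Prop :=
  p ≠ 0 ∧ p ∈ L.1 ∧ ∀ w ∈ L.1, (Polynomial.X : Polynomial ℂ) ^ k ∣
    MvPolynomial.aeval (fun i => Polynomial.C (p i) + Polynomial.C (w i) * Polynomial.X) C.form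

/-- No line is a component of `C`. -/
def ContainsNoLine : Prop := ∀ L : DualPlane, ∃ v ∈ L.1, MvPolynomial.eval v C.form ≠ 0

/-- The line `L` is a bitangent of `C`: it is not a component of `C`, and either it is tangent to
`C` at two different points, or it has contact of order four with `C` at one point. -/
def IsBitangent (L : DualPlane) : Prop :=
  (∃ v ∈ L.1, MvPolynomial.eval v C.form ≠ 0) ∧
    ((∃ p p' : V, LinearIndependent ℂ ![p, p'] ∧
        C.ContactAtLeast L p 2 ∧ C.ContactAtLeast L p' 2) ∨
      ∃ p : V, C.ContactAtLeast L p 4)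

end PlaneQuartic

/-- The point of `ℙ²` spanned by `p ∈ L` lies in the degree two subscheme `Z` of the line `L`. -/
def MemScheme (x : X) (p : x.line.1) : Prop := ∀ q ∈ tautFibre x, q p = 0

end QuarticBitangents

end

open QuarticBitangents

/-!
The argument is elementary: forms on a complex vector space are treated as functions, and the points
of `X` and of `E` through the parametrizations `mkX` and `mkE`.

*Action.* A matrix that preserves the ideal of a quartic multiplies its equation by a scalar, so each
element of `Aut(C₀)` has a representative in `GL₃` that fixes the equation of `C₀`
(`PlaneQuartic.exists_representative`). Two such representatives differ by a fourth root of unity,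
which acts trivially on quartic forms, so `F ↦ F ∘ A⁻¹` for these representatives is a natural
action `ρ` of `G` on `E`. If `G` preserves another quartic `C`, the same representatives multiply the
equation of `C` by scalars, which form the character `χ` (`PlaneQuartic.exists_natural_action`). A
twist of a natural action is natural, since scalar matrices act on `E` by arbitrary scalars
(`IsNatural.twist`), and natural actions are continuous because `GL₃` acts continuously on the
parameters (`IsNatural.isContinuous`).

*Bundle.* A basis `w, u, v` of `V` gives coordinates on `E` over the open set of the `(L, Z)` for
which `L` does not contain `w` and the projection `u'` of `u` to `L` from `w` is not in `Z`. If `q` is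
an equation of `Z`, each class in `Sym⁴ L^∨ / q²` has a unique representative that vanishes at `u'`,
and its values at the projections of the four points `v + k u` are the coordinates (`fibreCoord`).
A binary quartic is determined by its values at five points, and Lagrange interpolation with forms
on `V` that do not depend on `(L, Z)` gives the inverse. A local section of `mkX` of the same kind
(`sectionParam`) shows that the inverse is continuous, which yields `frameTrivialization`. In the
parameters, all of these coordinates are rational functions.

*Zeros.* The section vanishes at `(L, Z)` if and only if the equation of `C` on `L` is a multiple of
`q²`. A binary form vanishes at a point of the line if and only if it is divisible by the linear
equation `T` of the point, and it vanishes to order `k` there if and only if `T ^ k` divides it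
(`PlaneQuartic.contactAtLeast_iff`). A nonzero binary quartic is thus a multiple of a square exactly
if it has two double zeros or one zero of order four, and the square root is unique up to scalars
(`PlaneQuartic.bijOn_line`). If `C` contains the line `T = 0`, its equation is `T ψ`, and `C` is
singular at a zero of the cubic form `ψ` on the line (`PlaneQuartic.IsSmooth.containsNoLine`).
-/

noncomputable section

namespace QuarticBitangents

/-! ### Algebra of forms -/

section Forms

variable {M : Type} [AddCommGroup M] [Module ℂ M] {d e : ℕ} {φ ψ : M → ℂ}

theorem mul_mem_symPow (hφ : φ ∈ symPow M d) (hψ : ψ ∈ symPow M e) : φ * ψ ∈ symPow M (d + e) := by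
  rw [symPow, pow_add]
  exact Submodule.mul_mem_mul hφ hψ

theorem pow_mem_symPow (hφ : φ ∈ symPow M d) (k : ℕ) : φ ^ k ∈ symPow M (d * k) := by
  rw [symPow, pow_mul]
  exact Submodule.pow_mem_pow _ hφ k

theorem linearMap_mem_symPow (T : M →ₗ[ℂ] ℂ) : (T : M → ℂ) ∈ symPow M 1 := by
  rw [symPow, pow_one]
  exact ⟨T, rfl⟩

theorem exists_eq_const (hφ : φ ∈ symPow M 0) : ∃ c : ℂ, ∀ v, φ v = c := by
  rw [symPow, pow_zero, Submodule.mem_one] at hφ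
  obtain ⟨c, rfl⟩ := hφ
  exact ⟨c, fun _ => rfl⟩

/-- Forms of degree `d + 1` are sums of products of a linear functional with a form of degree
`d`. -/
theorem symPow_induction {p : (d : ℕ) → (M → ℂ) → Prop} (const : ∀ c : ℂ, p 0 (fun _ => c))
    (add : ∀ d, ∀ φ ∈ symPow M d, ∀ ψ ∈ symPow M d, p d φ → p d ψ → p d (φ + ψ))
    (mul : ∀ d, ∀ T : M →ₗ[ℂ] ℂ, ∀ φ ∈ symPow M d, p d φ → p (d + 1) (⇑T * φ))
    (hφ : φ ∈ symPow M d) : p d φ := by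
  refine Submodule.pow_induction_on_left' (C := fun d φ _ => p d φ) _ const
    (fun x y i hx hy => add i x hx y hy) ?_ hφ
  rintro _ ⟨T, rfl⟩ i x hx h
  exact mul i T x hx h

/-- Moving `v` by `-T v • w` changes the value of a form by a multiple of `T v`. If `T w = 1`, then
`v - T v • w` lies on the hyperplane `T = 0`. -/
theorem exists_eq_add_mul (T : M →ₗ[ℂ] ℂ) (w : M) (hφ : φ ∈ symPow M (d + 1)) :
    ∃ ψ ∈ symPow M d, ∀ v, φ v = φ (v - T v • w) + T v * ψ v := by
  suffices h : ∀ (n : ℕ) (φ : M → ℂ), φ ∈ symPow M n → ∀ d, n = d + 1 →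
      ∃ ψ ∈ symPow M d, ∀ v, φ v = φ (v - T v • w) + T v * ψ v from h _ _ hφ _ rfl
  intro n φ hφ
  refine symPow_induction (p := fun n φ => ∀ d, n = d + 1 →
      ∃ ψ ∈ symPow M d, ∀ v, φ v = φ (v - T v • w) + T v * ψ v) ?_ ?_ ?_ hφ
  · intro c d h
    omega
  · intro n φ _ φ' _ h h' d hd
    obtain ⟨ψ, hψ, h⟩ := h d hd
    obtain ⟨ψ', hψ', h'⟩ := h' d hd
    refine ⟨ψ + ψ', add_mem hψ hψ', fun v => ?_⟩
    simp only [Pi.add_apply]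
    rw [h v, h' v]
    ring
  · intro n ℓ φ hφ h d hd
    obtain rfl : n = d := by omega
    have hcomp (v : M) : ℓ (v - T v • w) = ℓ v - T v * ℓ w := by simp
    rcases n with _ | n
    · obtain ⟨c, hc⟩ := exists_eq_const hφ
      refine ⟨ℓ w • φ, Submodule.smul_mem _ _ hφ, fun v => ?_⟩
      simp only [Pi.mul_apply, Pi.smul_apply, hcomp, hc, smul_eq_mul]
      ring
    · obtain ⟨ψ, hψ, h⟩ := h n rfl
      have hproj : funPullback (LinearMap.id - T.smulRight w) φ ∈ symPow M (n + 1) :=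
        funPullback_mem _ _ hφ
      refine ⟨ℓ w • funPullback (LinearMap.id - T.smulRight w) φ + ⇑ℓ * ψ, add_mem
        (Submodule.smul_mem _ _ hproj) ?_, fun v => ?_⟩
      · rw [add_comm n 1]
        exact mul_mem_symPow (linearMap_mem_symPow ℓ) hψ
      · simp only [Pi.add_apply, Pi.mul_apply, Pi.smul_apply, funPullback_apply, smul_eq_mul,
          hcomp, LinearMap.sub_apply, LinearMap.id_apply, LinearMap.smulRight_apply]
        rw [h v]
        ring

/-- A form that vanishes on the hyperplane `T = 0` is divisible by `T`. -/
theorem exists_eq_mul_of_vanishing {T : M →ₗ[ℂ] ℂ} (hT : T ≠ 0) (hφ : φ ∈ symPow M (d + 1))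
    (h : ∀ v, T v = 0 → φ v = 0) : ∃ ψ ∈ symPow M d, φ = ⇑T * ψ := by
  obtain ⟨w, hw⟩ := LinearMap.surjective hT 1
  obtain ⟨ψ, hψ, hψ'⟩ := exists_eq_add_mul T w hφ
  refine ⟨ψ, hψ, funext fun v => ?_⟩
  rw [hψ' v, h (v - T v • w) (by simp [hw]), zero_add]
  rfl

/-- A form of degree `d` restricts to a polynomial of degree at most `d` on each affine line, and
its coefficient in degree `d` is the value of the form on the direction of the line. -/
theorem exists_polynomial (hφ : φ ∈ symPow M d) (u v : M) :
    ∃ P : Polynomial ℂ, P.natDegree ≤ d ∧ P.coeff d = φ v ∧ ∀ t, P.eval t = φ (u + t • v) := by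
  refine symPow_induction (p := fun d φ => ∃ P : Polynomial ℂ, P.natDegree ≤ d ∧
    P.coeff d = φ v ∧ ∀ t, P.eval t = φ (u + t • v)) ?_ ?_ ?_ hφ
  · intro c
    exact ⟨Polynomial.C c, by simp, by simp, by simp⟩
  · rintro d φ - ψ - ⟨P, h1, h2, h3⟩ ⟨Q, h4, h5, h6⟩
    exact ⟨P + Q, (Polynomial.natDegree_add_le P Q).trans (max_le h1 h4), by simp [h2, h5],
      by simp [h3, h6]⟩
  · rintro d T φ - ⟨P, h1, h2, h3⟩
    refine ⟨(Polynomial.C (T u) + Polynomial.C (T v) * Polynomial.X) * P, ?_, ?_, ?_⟩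
    · refine Polynomial.natDegree_mul_le.trans ?_
      rw [add_comm d 1]
      refine add_le_add ?_ h1
      compute_degree
    · rw [add_mul, Polynomial.coeff_add, Polynomial.coeff_C_mul, mul_assoc, Polynomial.coeff_C_mul,
        Polynomial.coeff_X_mul, h2, Polynomial.coeff_eq_zero_of_natDegree_lt (by omega)]
      simp
    · intro t
      simp only [Polynomial.eval_mul, Polynomial.eval_add, Polynomial.eval_C, Polynomial.eval_X, h3,
        Pi.mul_apply, map_add, map_smul, smul_eq_mul]
      ring

/-- Nonzero forms have nonzero products. -/
theorem eq_zero_or_eq_zero_of_mul_eq_zero (hφ : φ ∈ symPow M d) (hψ : ψ ∈ symPow M e)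
    (h : φ * ψ = 0) : φ = 0 ∨ ψ = 0 := by
  by_contra! hne
  obtain ⟨u, hu⟩ := Function.ne_iff.1 hne.1
  obtain ⟨v, hv⟩ := Function.ne_iff.1 hne.2
  obtain ⟨P, -, -, hP⟩ := exists_polynomial hφ u v
  obtain ⟨Q, -, hQ, hQ'⟩ := exists_polynomial hψ u v
  have hPQ : P * Q = 0 := by
    refine Polynomial.funext fun t => ?_
    rw [Polynomial.eval_mul, hP, hQ']
    simpa using congrFun h (u + t • v)
  rcases mul_eq_zero.1 hPQ with h0 | h0
  · have := hP 0
    simp [h0] at this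
    exact hu this.symm
  · rw [h0, Polynomial.coeff_zero] at hQ
    exact hv hQ.symm

/-- A form of positive degree has a nonzero zero in the span of two independent vectors. -/
theorem exists_zero (hφ : φ ∈ symPow M (d + 1)) {u v : M} (huv : LinearIndependent ℂ ![u, v]) :
    ∃ p ∈ Submodule.span ℂ {u, v}, p ≠ 0 ∧ φ p = 0 := by
  have hu : u ∈ Submodule.span ℂ {u, v} := Submodule.subset_span (by simp)
  have hv : v ∈ Submodule.span ℂ {u, v} := Submodule.subset_span (by simp)
  by_cases h0 : φ v = 0
  · exact ⟨v, hv, huv.ne_zero 1, h0⟩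
  obtain ⟨P, -, h2, h3⟩ := exists_polynomial hφ u v
  obtain ⟨t, ht⟩ := IsAlgClosed.exists_root P (by
    have h := Polynomial.le_degree_of_ne_zero (n := d + 1) (p := P) (by rwa [h2])
    intro h'
    rw [h'] at h
    norm_cast at h)
  refine ⟨u + t • v, add_mem hu (Submodule.smul_mem _ _ hv), fun h => ?_, by rw [← h3]; exact ht⟩
  have := LinearIndependent.pair_iff.1 huv 1 t (by simpa using h)
  exact one_ne_zero this.1

end Forms

/-! ### Binary forms -/

section Binary

variable {M : Type} [AddCommGroup M] [Module ℂ M] {d : ℕ} {φ : M → ℂ}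

/-- On a two-dimensional space, each point of the projective line has a linear equation. -/
theorem exists_equation (hM : Module.finrank ℂ M = 2) {p : M} (hp : p ≠ 0) :
    ∃ T : M →ₗ[ℂ] ℂ, T ≠ 0 ∧ ∀ v, T v = 0 ↔ ∃ c : ℂ, v = c • p := by
  have : FiniteDimensional ℂ M := Module.finite_of_finrank_eq_succ hM
  have h1 : Module.finrank ℂ (M ⧸ Submodule.span ℂ {p}) = 1 := by
    have h := Submodule.finrank_quotient_add_finrank (Submodule.span ℂ {p})
    rw [finrank_span_singleton hp, hM] at h
    omega
  obtain ⟨e⟩ := FiniteDimensional.nonempty_linearEquiv_of_finrank_eq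
    (h1.trans (Module.finrank_self ℂ).symm)
  have hker (v : M) : (e.toLinearMap ∘ₗ (Submodule.span ℂ {p}).mkQ) v = 0 ↔ ∃ c : ℂ, v = c • p := by
    rw [LinearMap.comp_apply, LinearEquiv.coe_coe, LinearEquiv.map_eq_zero_iff,
      Submodule.mkQ_apply, Submodule.Quotient.mk_eq_zero, Submodule.mem_span_singleton]
    simp only [eq_comm]
  refine ⟨e.toLinearMap ∘ₗ (Submodule.span ℂ {p}).mkQ, fun h => ?_, hker⟩
  have : LinearMap.range (e.toLinearMap ∘ₗ (Submodule.span ℂ {p}).mkQ) = ⊤ :=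
    LinearMap.range_eq_top.2 (e.surjective.comp (Submodule.mkQ_surjective _))
  rw [h, LinearMap.range_zero] at this
  exact bot_ne_top this

theorem exists_eq_mul_of_apply_eq_zero {T : M →ₗ[ℂ] ℂ} (hT : T ≠ 0) {p : M}
    (hTp : ∀ v, T v = 0 ↔ ∃ c : ℂ, v = c • p) (hφ : φ ∈ symPow M (d + 1)) (h : φ p = 0) :
    ∃ ψ ∈ symPow M d, φ = ⇑T * ψ := by
  refine exists_eq_mul_of_vanishing hT hφ fun v hv => ?_
  obtain ⟨c, rfl⟩ := (hTp v).1 hv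
  rw [symPow_smul _ hφ, h, mul_zero]

/-- Order of vanishing at a point of the projective line, through factorization and through Taylor
expansion. -/
theorem exists_eq_pow_mul {T : M →ₗ[ℂ] ℂ} (hT : T ≠ 0) {p w : M}
    (hTp : ∀ v, T v = 0 ↔ ∃ c : ℂ, v = c • p) (hw : T w ≠ 0) (k : ℕ) (hφ : φ ∈ symPow M (d + k))
    {P : Polynomial ℂ} (hP : ∀ t, P.eval t = φ (p + t • w)) (hk : Polynomial.X ^ k ∣ P) :
    ∃ ψ ∈ symPow M d, φ = ⇑T ^ k * ψ := by
  induction k generalizing φ P with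
  | zero => exact ⟨φ, hφ, by simp⟩
  | succ k ih =>
    obtain ⟨Q, rfl⟩ := hk
    have h0 : φ p = 0 := by
      have := hP 0
      simpa using this.symm
    obtain ⟨ψ, hψ, rfl⟩ := exists_eq_mul_of_apply_eq_zero (d := d + k) hT hTp hφ h0
    obtain ⟨R, -, -, hR⟩ := exists_polynomial hψ p w
    have hp : T p = 0 := (hTp p).2 ⟨1, by simp⟩
    have hQR : Polynomial.X ^ (k + 1) * Q = Polynomial.X * (Polynomial.C (T w) * R) := by
      refine Polynomial.funext fun t => ?_
      rw [hP]
      simp [hR, hp, mul_assoc]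
    rw [pow_succ', mul_assoc] at hQR
    have hQR' := mul_left_cancel₀ Polynomial.X_ne_zero hQR
    have hdvd : Polynomial.X ^ k ∣ R :=
      ((Polynomial.isUnit_C.2 (isUnit_iff_ne_zero.2 hw)).dvd_mul_left).1 ⟨Q, hQR'.symm⟩
    obtain ⟨ψ', hψ', rfl⟩ := ih hψ hR hdvd
    exact ⟨ψ', hψ', by ring⟩

theorem pow_dvd_of_eq_pow_mul {T : M →ₗ[ℂ] ℂ} {p : M} (hp : T p = 0) (w : M) {k : ℕ} {ψ : M → ℂ}
    (hψ : ψ ∈ symPow M d) (hφ : φ = ⇑T ^ k * ψ) {P : Polynomial ℂ}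
    (hP : ∀ t, P.eval t = φ (p + t • w)) : Polynomial.X ^ k ∣ P := by
  obtain ⟨R, -, -, hR⟩ := exists_polynomial hψ p w
  refine ⟨Polynomial.C (T w) ^ k * R, Polynomial.funext fun t => ?_⟩
  rw [hP, hφ]
  simp [hR, hp, mul_pow, mul_assoc]

/-- A binary form of degree `d` that vanishes at the points `(1 : 0)` and `(t : 1)`, for `d` values
of `t`, is zero. -/
theorem eq_zero_of_vanishing_at {u v : M} (huv : ∀ x : M, ∃ a b : ℂ, x = a • u + b • v)
    (hφ : φ ∈ symPow M d) (hu : φ u = 0) (h : ∀ k < d, φ (v + (k : ℂ) • u) = 0) : φ = 0 := by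
  rcases d with _ | d
  · obtain ⟨c, hc⟩ := exists_eq_const hφ
    funext x
    rw [hc, ← hc u, hu]
    rfl
  obtain ⟨P, h1, h2, h3⟩ := exists_polynomial hφ v u
  have hP : P = 0 := by
    refine Polynomial.eq_zero_of_natDegree_lt_card_of_eval_eq_zero P
      (f := fun k : Fin (d + 1) => (k : ℂ)) (fun i j hij => Fin.ext (Nat.cast_injective hij))
      (fun k => by rw [h3]; exact h k k.2) ?_
    rw [Fintype.card_fin]
    refine lt_of_le_of_ne h1 fun h' => ?_
    rw [hu, ← h', Polynomial.coeff_natDegree, Polynomial.leadingCoeff_eq_zero] at h2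
    rw [h2] at h'
    simp at h'
  funext x
  obtain ⟨a, b, rfl⟩ := huv x
  by_cases hb : b = 0
  · rw [hb, zero_smul, add_zero, symPow_smul _ hφ, hu, mul_zero]
    rfl
  · have : a • u + b • v = b • (v + (a / b) • u) := by
      rw [smul_add, smul_smul, mul_div_cancel₀ _ hb, add_comm]
    rw [this, symPow_smul _ hφ, ← h3, hP]
    simp

end Binary

/-! ### Zeros of the induced section and bitangents -/

section Scheme

variable {x : X} {q : symPow x.line.1 2}

theorem tautFibre_eq_span (hq : q ≠ 0) (h : x.scheme = Projectivization.mk ℂ q hq) :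
    tautFibre x = Submodule.span ℂ {(q : x.line.1 → ℂ)} := by
  rw [tautFibre, h, Projectivization.submodule_mk, Submodule.map_span, Set.image_singleton]
  rfl

theorem mem_tautSqFibre_iff (hq : q ≠ 0) (h : x.scheme = Projectivization.mk ℂ q hq)
    {φ : symPow x.line.1 4} :
    φ ∈ tautSqFibre x ↔ ∃ c : ℂ, (φ : x.line.1 → ℂ) = c • (q : x.line.1 → ℂ) ^ 2 := by
  rw [tautSqFibre, Submodule.mem_comap, tautFibre_eq_span hq h, Submodule.span_pow,
    Set.singleton_pow, Submodule.mem_span_singleton]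
  simp only [Submodule.subtype_apply, eq_comm]

theorem memScheme_iff (hq : q ≠ 0) (h : x.scheme = Projectivization.mk ℂ q hq) {p : x.line.1} :
    MemScheme x p ↔ (q : x.line.1 → ℂ) p = 0 := by
  rw [MemScheme, tautFibre_eq_span hq h]
  constructor
  · exact fun h => h q (Submodule.mem_span_singleton_self _)
  · intro h φ hφ
    obtain ⟨a, rfl⟩ := Submodule.mem_span_singleton.1 hφ
    simp [h]

end Scheme

/-- Two vectors spanning different lines are independent. -/
theorem linearIndependent_pair_of_equation {M : Type} [AddCommGroup M] [Module ℂ M] {p p' : M}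
    (hp : p ≠ 0) {T : M →ₗ[ℂ] ℂ} (hT : T p = 0) (hT' : T p' ≠ 0) :
    LinearIndependent ℂ ![p, p'] := by
  refine LinearIndependent.pair_iff.2 fun s t h => ?_
  have ht : t = 0 := by
    have := congrArg T h
    simpa [hT, hT'] using this
  subst ht
  simpa [hp] using h

theorem exists_linearIndependent {M : Type} [AddCommGroup M] [Module ℂ M]
    (hM : Module.finrank ℂ M = 2) : ∃ u v : M, LinearIndependent ℂ ![u, v] := by
  have : FiniteDimensional ℂ M := Module.finite_of_finrank_eq_succ hM
  let b := Module.finBasisOfFinrankEq ℂ M hM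
  refine ⟨b 0, b 1, ?_⟩
  convert b.linearIndependent using 1
  ext i
  fin_cases i <;> rfl

theorem exists_ker_eq_line (L : DualPlane) : ∃ T : V →ₗ[ℂ] ℂ, T ≠ 0 ∧ LinearMap.ker T = L.1 := by
  obtain ⟨T, hT, hLT⟩ := L.1.exists_le_ker_of_lt_top (lt_top_iff_ne_top.2 fun h => by
    have := L.2
    rw [h, finrank_top, Module.finrank_fin_fun] at this
    omega)
  refine ⟨T, hT, (Submodule.eq_of_le_of_finrank_eq hLT ?_).symm⟩
  have h := LinearMap.finrank_range_add_finrank_ker T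
  rw [LinearMap.range_eq_top.2 (LinearMap.surjective hT), finrank_top, Module.finrank_self,
    Module.finrank_fin_fun] at h
  have := L.2
  omega

/-- A binary form of positive degree has a zero on the projective line. -/
theorem exists_zero_of_finrank_eq_two {M : Type} [AddCommGroup M] [Module ℂ M]
    (hM : Module.finrank ℂ M = 2) {d : ℕ} {φ : M → ℂ} (hφ : φ ∈ symPow M (d + 1)) :
    ∃ p : M, p ≠ 0 ∧ φ p = 0 := by
  obtain ⟨u, v, huv⟩ := exists_linearIndependent hM
  obtain ⟨p, -, hp⟩ := exists_zero hφ huv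
  exact ⟨p, hp⟩

namespace PlaneQuartic

variable (C : PlaneQuartic)

/-- The equation of `C` on the line `L`. -/
def onLine (L : DualPlane) : L.1 → ℂ := fun v => MvPolynomial.eval (v : V) C.form

theorem onLine_mem (L : DualPlane) : C.onLine L ∈ symPow L.1 4 := (symRestrict L.1 4 C.toSym).2

theorem inducedSection_eq_zero_iff {L : DualPlane} {q : symPow L.1 2} (hq : q ≠ 0) :
    C.inducedSection ⟨L, Projectivization.mk ℂ q hq⟩ = 0 ↔
      ∃ c : ℂ, C.onLine L = c • (q : L.1 → ℂ) ^ 2 :=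
  (Submodule.Quotient.mk_eq_zero _).trans (mem_tautSqFibre_iff hq rfl)

theorem eval_contact_polynomial (f : MvPolynomial (Fin 3) ℂ) (p w : V) (t : ℂ) :
    (MvPolynomial.aeval (fun i => Polynomial.C (p i) + Polynomial.C (w i) * Polynomial.X)
      f : Polynomial ℂ).eval t = MvPolynomial.eval (p + t • w) f := by
  have h : (Polynomial.aeval t).comp (MvPolynomial.aeval
      (fun i => Polynomial.C (p i) + Polynomial.C (w i) * Polynomial.X)) =
      MvPolynomial.aeval (p + t • w) := by
    apply MvPolynomial.algHom_ext
    intro i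
    simp only [AlgHom.comp_apply, MvPolynomial.aeval_X, map_add, map_mul, Polynomial.aeval_C,
      Polynomial.aeval_X, Algebra.algebraMap_self, RingHom.id_apply, Pi.add_apply, Pi.smul_apply,
      smul_eq_mul, mul_comm]
  have := DFunLike.congr_fun h f
  simpa [Polynomial.coe_aeval_eq_eval, MvPolynomial.coe_aeval_eq_eval] using this

/-- Intersection multiplicity at a point as the order of the linear equation of the point in the
equation of `C` on the line. -/
theorem contactAtLeast_iff {L : DualPlane} {p : L.1} (hp : p ≠ 0) {T : L.1 →ₗ[ℂ] ℂ} (hT : T ≠ 0)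
    (hTp : ∀ v, T v = 0 ↔ ∃ c : ℂ, v = c • p) {k d : ℕ} (hk : d + k = 4) :
    C.ContactAtLeast L p k ↔ ∃ ψ ∈ symPow L.1 d, C.onLine L = ⇑T ^ k * ψ := by
  constructor
  · rintro ⟨-, -, h⟩
    obtain ⟨w, hw⟩ := LinearMap.surjective hT 1
    exact exists_eq_pow_mul hT hTp (w := w) (by simp [hw]) k (by rw [hk]; exact C.onLine_mem L)
      (fun t => eval_contact_polynomial C.form p w t) (h w w.2)
  · rintro ⟨ψ, hψ, h⟩
    refine ⟨by simpa using hp, p.2, fun w hw => ?_⟩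
    exact pow_dvd_of_eq_pow_mul ((hTp p).2 ⟨1, by simp⟩) ⟨w, hw⟩ hψ h
      (fun t => eval_contact_polynomial C.form p w t)

variable {C}

theorem ContactAtLeast.onLine_eq_zero {L : DualPlane} {p : L.1} {k : ℕ}
    (h : C.ContactAtLeast L p (k + 1)) : C.onLine L p = 0 := by
  have h0 := eval_contact_polynomial C.form p 0 0
  rw [zero_smul, add_zero] at h0
  obtain ⟨Q, hQ⟩ := h.2.2 0 L.1.zero_mem
  rw [hQ] at h0
  exact h0.symm.trans (by simp)

theorem ContainsNoLine.onLine_ne_zero (hC : C.ContainsNoLine) (L : DualPlane) :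
    C.onLine L ≠ 0 := by
  obtain ⟨v, hv, h⟩ := hC L
  exact fun h' => h (congrFun h' ⟨v, hv⟩)

/-- If the equation of `C` on `L` is a nonzero multiple of the square of `q`, then `C` has contact
of order at least two with `L` exactly at the zeros of `q`. -/
theorem contactAtLeast_two_iff {L : DualPlane} {q : L.1 → ℂ} (hq : q ∈ symPow L.1 2) {c : ℂ}
    (hc : c ≠ 0) (h : C.onLine L = c • q ^ 2) {p : L.1} (hp : p ≠ 0) :
    C.ContactAtLeast L p 2 ↔ q p = 0 := by
  constructor
  · intro hcon
    have := hcon.onLine_eq_zero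
    rw [h] at this
    simpa [hc] using this
  · intro hqp
    obtain ⟨T, hT, hTp⟩ := exists_equation L.2 hp
    obtain ⟨ψ, hψ, rfl⟩ := exists_eq_mul_of_apply_eq_zero (d := 1) hT hTp hq hqp
    refine (C.contactAtLeast_iff hp hT hTp (d := 2) rfl).2 ⟨c • ψ ^ 2,
      Submodule.smul_mem _ _ (pow_mem_symPow hψ 2), ?_⟩
    rw [h, mul_pow, mul_smul_comm]

/-- A line on which the equation of `C` is a nonzero multiple of a square is a bitangent. -/
theorem isBitangent_of_eq_sq {L : DualPlane} {q : L.1 → ℂ} (hq : q ∈ symPow L.1 2) {c : ℂ}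
    (hL : C.onLine L ≠ 0) (h : C.onLine L = c • q ^ 2) : C.IsBitangent L := by
  have hc : c ≠ 0 := by
    rintro rfl
    exact hL (by simpa using h)
  refine ⟨?_, ?_⟩
  · obtain ⟨v, hv⟩ := Function.ne_iff.1 hL
    exact ⟨v, v.2, hv⟩
  obtain ⟨p, hp, hqp⟩ := exists_zero_of_finrank_eq_two L.2 (d := 1) hq
  obtain ⟨T, hT, hTp⟩ := exists_equation L.2 hp
  obtain ⟨ψ, hψ, rfl⟩ := exists_eq_mul_of_apply_eq_zero (d := 1) hT hTp hq hqp
  obtain ⟨p', hp', hψp'⟩ := exists_zero_of_finrank_eq_two L.2 (d := 0) hψ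
  by_cases hpp : T p' = 0
  · right
    -- both zeros of `q` coincide, so that `q` is a multiple of `T ^ 2`
    have hψp : ψ p = 0 := by
      obtain ⟨a, rfl⟩ := (hTp p').1 hpp
      have ha : a ≠ 0 := fun ha => hp' (by simp [ha])
      rw [symPow_smul _ hψ] at hψp'
      simpa [ha] using hψp'
    obtain ⟨ψ', hψ', rfl⟩ := exists_eq_mul_of_apply_eq_zero (d := 0) hT hTp hψ hψp
    refine ⟨p, (C.contactAtLeast_iff hp hT hTp (d := 0) rfl).2 ⟨c • ψ' ^ 2,
      Submodule.smul_mem _ _ (pow_mem_symPow hψ' 2), ?_⟩⟩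
    rw [h, mul_smul_comm]
    ring_nf
  · left
    have hind := linearIndependent_pair_of_equation hp ((hTp p).2 ⟨1, by simp⟩) hpp
    refine ⟨p, p', ?_, (contactAtLeast_two_iff hq hc h hp).2 hqp,
      (contactAtLeast_two_iff hq hc h hp').2 (by simp [hψp'])⟩
    rw [LinearIndependent.pair_iff] at hind ⊢
    exact fun s t hst => hind s t (Subtype.ext hst)

/-- On a bitangent the equation of `C` is a multiple of a square. -/
theorem IsBitangent.exists_eq_sq {L : DualPlane} (h : C.IsBitangent L) :
    ∃ q ∈ symPow L.1 2, q ≠ 0 ∧ ∃ c : ℂ, C.onLine L = c • q ^ 2 := by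
  have hne {T T' : L.1 →ₗ[ℂ] ℂ} (hT : T ≠ 0) (hT' : T' ≠ 0) : (⇑T * ⇑T' : L.1 → ℂ) ≠ 0 := by
    intro h0
    rcases eq_zero_or_eq_zero_of_mul_eq_zero (linearMap_mem_symPow T) (linearMap_mem_symPow T') h0
      with h1 | h1
    · exact hT (DFunLike.coe_injective h1)
    · exact hT' (DFunLike.coe_injective h1)
  have hmem (T T' : L.1 →ₗ[ℂ] ℂ) : (⇑T * ⇑T' : L.1 → ℂ) ∈ symPow L.1 2 :=
    mul_mem_symPow (linearMap_mem_symPow T) (linearMap_mem_symPow T')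
  rcases h.2 with ⟨p, p', hind, h1, h2⟩ | ⟨p, h4⟩
  · lift p to L.1 using h1.2.1
    lift p' to L.1 using h2.2.1
    have hp : p ≠ 0 := by simpa using h1.1
    have hp' : p' ≠ 0 := by simpa using h2.1
    obtain ⟨T, hT, hTp⟩ := exists_equation L.2 hp
    obtain ⟨T', hT', hTp'⟩ := exists_equation L.2 hp'
    have hTp0 : T p' ≠ 0 := by
      intro h0
      obtain ⟨a, rfl⟩ := (hTp p').1 h0
      have := (LinearIndependent.pair_iff.1 hind (-a) 1 (by simp)).2
      exact one_ne_zero this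
    obtain ⟨ψ, hψ, hφ⟩ := (C.contactAtLeast_iff hp hT hTp (d := 2) rfl).1 h1
    -- `T ^ 2` is a unit at `p'`, so that `ψ` vanishes there to order two
    obtain ⟨w, hw⟩ := LinearMap.surjective hT' 1
    obtain ⟨R, -, -, hR⟩ := exists_polynomial hψ p' w
    obtain ⟨Q, -, -, hQ⟩ := exists_polynomial (linearMap_mem_symPow T) p' w
    have hdvd : Polynomial.X ^ 2 ∣ R := by
      have hcop : IsCoprime (Polynomial.X ^ 2 : Polynomial ℂ) (Q ^ 2) := by
        refine IsCoprime.pow ?_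
        rw [Polynomial.irreducible_X.coprime_iff_not_dvd, Polynomial.X_dvd_iff,
          Polynomial.coeff_zero_eq_eval_zero, hQ]
        simpa using hTp0
      refine hcop.dvd_of_dvd_mul_left ?_
      have := h2.2.2 w w.2
      convert this using 1
      refine Polynomial.funext fun t => ?_
      rw [eval_contact_polynomial, Polynomial.eval_mul, Polynomial.eval_pow, hR, hQ]
      exact (congrFun hφ (p' + t • w)).symm
    obtain ⟨ψ', hψ', rfl⟩ := exists_eq_pow_mul (d := 0) hT' hTp' (by simp [hw]) 2 hψ hR hdvd
    obtain ⟨c, hc⟩ := exists_eq_const hψ'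
    refine ⟨⇑T * ⇑T', hmem T T', hne hT hT', c, ?_⟩
    rw [hφ]
    funext v
    simp only [Pi.mul_apply, Pi.pow_apply, Pi.smul_apply, smul_eq_mul, hc]
    ring
  · lift p to L.1 using h4.2.1
    have hp : p ≠ 0 := by simpa using h4.1
    obtain ⟨T, hT, hTp⟩ := exists_equation L.2 hp
    obtain ⟨ψ, hψ, hφ⟩ := (C.contactAtLeast_iff hp hT hTp (d := 0) rfl).1 h4
    obtain ⟨c, hc⟩ := exists_eq_const hψ
    refine ⟨⇑T * ⇑T, hmem T T, hne hT hT, c, ?_⟩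
    rw [hφ]
    funext v
    simp only [Pi.mul_apply, Pi.pow_apply, Pi.smul_apply, smul_eq_mul, hc]
    ring

/-- Two quadratic forms with proportional nonzero squares are proportional. -/
theorem mk_eq_mk_of_sq_eq {L : DualPlane} {q q' : symPow L.1 2} (hq : q ≠ 0) (hq' : q' ≠ 0)
    {c : ℂ} (hc : c ≠ 0) (h : (q : L.1 → ℂ) ^ 2 = c • (q' : L.1 → ℂ) ^ 2) :
    Projectivization.mk ℂ q hq = Projectivization.mk ℂ q' hq' := by
  obtain ⟨a, ha⟩ := IsAlgClosed.exists_pow_nat_eq c (n := 2) (by norm_num)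
  have ha0 : a ≠ 0 := by
    rintro rfl
    exact hc (by simpa using ha.symm)
  have hmul : ((q - a • q' : symPow L.1 2) : L.1 → ℂ) * (q + a • q' : symPow L.1 2) = 0 := by
    funext v
    have := congrFun h v
    simp only [Pi.pow_apply, Pi.smul_apply, smul_eq_mul, ← ha] at this
    simp only [Submodule.coe_sub, Submodule.coe_add, Submodule.coe_smul, Pi.mul_apply,
      Pi.sub_apply, Pi.add_apply, Pi.smul_apply, smul_eq_mul, Pi.zero_apply]
    linear_combination this
  rw [Projectivization.mk_eq_mk_iff']
  rcases eq_zero_or_eq_zero_of_mul_eq_zero (q - a • q').2 (q + a • q').2 hmul with h0 | h0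
  · exact ⟨a, (sub_eq_zero.1 (Subtype.ext h0)).symm⟩
  · exact ⟨-a, by rw [neg_smul]; exact (eq_neg_of_add_eq_zero_left (Subtype.ext h0)).symm⟩

theorem bijOn_line (hC : C.ContainsNoLine) :
    Set.BijOn X.line {x | C.inducedSection x = 0} {L | C.IsBitangent L} := by
  refine ⟨?_, ?_, ?_⟩
  · rintro ⟨L, Z⟩ h
    induction Z using Projectivization.ind with
    | h q hq =>
      obtain ⟨c, hc⟩ := (C.inducedSection_eq_zero_iff hq).1 h
      exact isBitangent_of_eq_sq q.2 (hC.onLine_ne_zero L) hc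
  · rintro ⟨L, Z⟩ h ⟨L', Z'⟩ h' (rfl : L = L')
    induction Z using Projectivization.ind with
    | h q hq =>
    induction Z' using Projectivization.ind with
    | h q' hq' =>
      obtain ⟨c, hc⟩ := (C.inducedSection_eq_zero_iff hq).1 h
      obtain ⟨c', hc'⟩ := (C.inducedSection_eq_zero_iff hq').1 h'
      have hL := hC.onLine_ne_zero L
      have hc0 : c ≠ 0 := by
        rintro rfl
        exact hL (by simpa using hc)
      have hc0' : c' ≠ 0 := by
        rintro rfl
        exact hL (by simpa using hc')
      rw [mk_eq_mk_of_sq_eq hq hq' (c := c⁻¹ * c') (by simp [hc0, hc0'])]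
      rw [mul_smul, ← hc', hc, smul_smul, inv_mul_cancel₀ hc0, one_smul]
  · intro L hL
    obtain ⟨q, hq, hq0, hc⟩ := hL.exists_eq_sq
    have hq0' : (⟨q, hq⟩ : symPow L.1 2) ≠ 0 := fun h => hq0 (congrArg Subtype.val h)
    exact ⟨⟨L, Projectivization.mk ℂ ⟨q, hq⟩ hq0'⟩, (C.inducedSection_eq_zero_iff hq0').2 hc, rfl⟩

theorem memScheme_iff_contactAtLeast (hC : C.ContainsNoLine) (x : X) (h : C.inducedSection x = 0)
    (p : x.line.1) (hp : p ≠ 0) : MemScheme x p ↔ C.ContactAtLeast x.line p 2 := by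
  obtain ⟨L, Z⟩ := x
  induction Z using Projectivization.ind with
  | h q hq =>
    obtain ⟨c, hc⟩ := (C.inducedSection_eq_zero_iff hq).1 h
    have hc0 : c ≠ 0 := by
      rintro rfl
      exact hC.onLine_ne_zero L (by simpa using hc)
    exact (memScheme_iff hq rfl).trans (contactAtLeast_two_iff q.2 hc0 hc hp).symm

/-! ### Smooth quartics contain no line -/

/-- The first-order term of a polynomial at `p` in the direction `w` is given by its gradient. -/
theorem derivative_contact_polynomial (p w : V) (f : MvPolynomial (Fin 3) ℂ) :
    (Polynomial.derivative (MvPolynomial.aeval (fun i => Polynomial.C (p i) +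
      Polynomial.C (w i) * Polynomial.X) f : Polynomial ℂ)).eval 0 =
      ∑ i, w i * MvPolynomial.eval p (MvPolynomial.pderiv i f) := by
  have h0 (g : MvPolynomial (Fin 3) ℂ) : (MvPolynomial.aeval (fun i => Polynomial.C (p i) +
      Polynomial.C (w i) * Polynomial.X) g : Polynomial ℂ).eval 0 = MvPolynomial.eval p g := by
    rw [eval_contact_polynomial, zero_smul, add_zero]
  induction f using MvPolynomial.induction_on with
  | C a => simp
  | add f g hf hg => simp [hf, hg, mul_add, Finset.sum_add_distrib]
  | mul_X f j hf =>
    have hsum : ∑ i, w i * (MvPolynomial.eval p f * MvPolynomial.eval p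
        (MvPolynomial.pderiv i (MvPolynomial.X j))) = MvPolynomial.eval p f * w j := by
      rw [Finset.sum_eq_single j]
      · simp [mul_comm]
      · intro i _ hij
        simp [MvPolynomial.pderiv_X, hij.symm]
      · simp
    have hsum' : ∑ i, w i * (p j * MvPolynomial.eval p (MvPolynomial.pderiv i f)) =
        (∑ i, w i * MvPolynomial.eval p (MvPolynomial.pderiv i f)) * p j := by
      rw [Finset.sum_mul]
      exact Finset.sum_congr rfl fun i _ => by ring
    simp only [map_mul, Polynomial.derivative_mul, Polynomial.eval_add, Polynomial.eval_mul, hf, h0,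
      MvPolynomial.aeval_X, MvPolynomial.eval_X, Derivation.leibniz, smul_eq_mul, map_add, mul_add,
      Finset.sum_add_distrib, hsum, hsum']
    simp [add_comm]

/-- A quartic containing the line `T = 0` has an equation `T * ψ`, and is singular at the zeros of
the cubic form `ψ` on the line. -/
theorem IsSmooth.containsNoLine (hC : C.IsSmooth) : C.ContainsNoLine := by
  intro L
  by_contra! hL
  obtain ⟨T, hT, hker⟩ := exists_ker_eq_line L
  obtain ⟨ψ, hψ, h⟩ := exists_eq_mul_of_vanishing (d := 3) hT C.eval_form_mem fun v hv =>
    hL v (by rw [← hker]; exact hv)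
  obtain ⟨u, v, huv⟩ := exists_linearIndependent L.2
  have huv' : LinearIndependent ℂ ![(u : V), (v : V)] := by
    rw [LinearIndependent.pair_iff] at huv ⊢
    exact fun s t hst => huv s t (Subtype.ext hst)
  obtain ⟨p, hp, hp0, hψp⟩ := exists_zero (d := 2) hψ huv'
  have hpL : p ∈ L.1 := Submodule.span_le.2 (by
    rintro x (rfl | rfl)
    exacts [u.2, v.2]) hp
  have hTp : T p = 0 := by
    rw [← hker] at hpL
    exact hpL
  obtain ⟨i, hi⟩ := hC p hp0 (hL p hpL)
  apply hi
  obtain ⟨R, -, -, hR⟩ := exists_polynomial hψ p (Pi.single i 1)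
  have hP : MvPolynomial.aeval (fun j => Polynomial.C (p j) + Polynomial.C
      ((Pi.single i 1 : V) j) * Polynomial.X) C.form =
      Polynomial.C (T (Pi.single i 1)) * Polynomial.X * R := by
    refine Polynomial.funext fun t => ?_
    rw [eval_contact_polynomial, congrFun h (p + t • Pi.single i 1)]
    simp only [Pi.mul_apply, map_add, map_smul, hTp, smul_eq_mul, Polynomial.eval_mul,
      Polynomial.eval_C, Polynomial.eval_X, hR]
    ring
  have hd := derivative_contact_polynomial p (Pi.single i 1) C.form
  have hR0 := hR 0
  rw [zero_smul, add_zero, hψp] at hR0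
  rw [hP] at hd
  simpa [hR0, Pi.single_apply] using hd.symm

end PlaneQuartic

/-! ### The parametrizations of `X` and of the total space of `E` -/

theorem exists_linForm (T : V →ₗ[ℂ] ℂ) : ∃ a, linForm a = T := by
  refine ⟨fun i => T (Pi.single i 1), LinearMap.pi_ext' fun i => LinearMap.ext_ring ?_⟩
  simp [linForm_apply, Pi.single_apply]

theorem coefForm_surjective (d : ℕ) : Function.Surjective (coefForm d) := by
  rw [← LinearMap.range_eq_top, Submodule.eq_top_iff']
  rintro ⟨φ, hφ⟩
  have hlin : LinearMap.range (LinearMap.ltoFun ℂ V ℂ ℂ) =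
      Submodule.span ℂ (Set.range fun (i : Fin 3) (v : V) => v i) := by
    refine le_antisymm ?_ (Submodule.span_le.2 ?_)
    · rintro _ ⟨T, rfl⟩
      obtain ⟨a, rfl⟩ := exists_linForm T
      have : LinearMap.ltoFun ℂ V ℂ ℂ (linForm a) = ∑ i, a i • fun v : V => v i := by
        funext v
        simp [linForm_apply]
      rw [this]
      exact Submodule.sum_mem _ fun i _ => Submodule.smul_mem _ _ (Submodule.subset_span ⟨i, rfl⟩)
    · rintro _ ⟨i, rfl⟩
      exact ⟨LinearMap.proj i, rfl⟩
  have hmap : φ ∈ Submodule.map (symPow V d).subtype (LinearMap.range (coefForm d)) := by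
    rw [symPow, hlin, Submodule.span_pow] at hφ
    refine Submodule.span_le.2 ?_ hφ
    intro ψ hψ
    obtain ⟨f, rfl⟩ := Set.mem_pow.1 hψ
    choose i hi using fun k => (f k).2
    refine ⟨coefForm d (Pi.single i 1), ⟨_, rfl⟩, ?_⟩
    funext v
    rw [Submodule.subtype_apply, coefForm_apply, List.prod_ofFn]
    simp [Pi.single_apply, ← hi]
  obtain ⟨ψ, hψ, rfl⟩ := hmap
  exact hψ

/-- A choice of coefficients for each form, depending linearly on the form. -/
def formCoef (d : ℕ) : symPow V d →ₗ[ℂ] Coef d :=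
  ((coefForm d).exists_rightInverse_of_surjective
    (LinearMap.range_eq_top.2 (coefForm_surjective d))).choose

@[simp]
theorem coefForm_formCoef (d : ℕ) (φ : symPow V d) : coefForm d (formCoef d φ) = φ :=
  LinearMap.congr_fun ((coefForm d).exists_rightInverse_of_surjective
    (LinearMap.range_eq_top.2 (coefForm_surjective d))).choose_spec φ

-- Unification should not unfold the sums over multi-indices in these definitions.
attribute [local irreducible] coefForm linForm formCoef

theorem exists_line_equation (L : DualPlane) : ∃ a : V, a ≠ 0 ∧ LinearMap.ker (linForm a) = L.1 := by
  obtain ⟨T, hT, hker⟩ := exists_ker_eq_line L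
  obtain ⟨a, rfl⟩ := exists_linForm T
  refine ⟨a, ?_, hker⟩
  rintro rfl
  exact hT (LinearMap.ext fun v => by simp [linForm_apply])

theorem symRestrict_surjective (L : Submodule ℂ V) (d : ℕ) :
    Function.Surjective (symRestrict L d) := by
  obtain ⟨P, hP⟩ := L.subtype.exists_leftInverse_of_injective (Submodule.ker_subtype L)
  refine fun φ => ⟨symPullback P d φ, ?_⟩
  ext v
  exact congrArg (φ : L → ℂ) (LinearMap.congr_fun hP v)

theorem mkX_eq {p : paramSet} {L : DualPlane} (hL : LinearMap.ker (linForm p.1.1) = L.1)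
    {q : symPow L.1 2} (hq : q ≠ 0)
    (h : ∀ (v : V) (hv : v ∈ L.1), (coefForm 2 p.1.2 : V → ℂ) v = (q : L.1 → ℂ) ⟨v, hv⟩) :
    mkX p = ⟨L, Projectivization.mk ℂ q hq⟩ := by
  refine X_ext (L' := L) (Subtype.ext hL) _ p.2.2 q hq 1 fun v hv hv' => ?_
  rw [Units.val_one, one_mul]
  exact h v hv'

theorem mkX_surjective : Function.Surjective mkX := by
  rintro ⟨L, Z⟩
  obtain ⟨a, ha, haL⟩ := exists_line_equation L
  induction Z using Projectivization.ind with
  | h q hq =>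
    obtain ⟨φ, rfl⟩ := symRestrict_surjective _ 2 q
    have hp : (a, formCoef 2 φ) ∈ paramSet := by
      refine ⟨ha, ?_⟩
      change symRestrict (LinearMap.ker (linForm a)) 2 (coefForm 2 (formCoef 2 φ)) ≠ 0
      rw [coefForm_formCoef, haL]
      exact hq
    refine ⟨⟨_, hp⟩, mkX_eq haL hq fun v hv => ?_⟩
    change (coefForm 2 (formCoef 2 φ) : V → ℂ) v = _
    rw [coefForm_formCoef]
    rfl

/-- Points of the total space of `E` are equal if they lie over the same point and are represented
by forms with equal values. -/
theorem totalSpace_ext {x x' : X} (h : x = x') (φ : symPow x.line.1 4) (φ' : symPow x'.line.1 4)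
    (hφ : ∀ (v : V) (hv : v ∈ x.line.1) (hv' : v ∈ x'.line.1),
      (φ : x.line.1 → ℂ) ⟨v, hv⟩ = (φ' : x'.line.1 → ℂ) ⟨v, hv'⟩) :
    (⟨x, Submodule.Quotient.mk φ⟩ : TotalSpace ModelFibre E) =
      ⟨x', Submodule.Quotient.mk φ'⟩ := by
  obtain rfl := h
  have : φ = φ' := by
    ext v
    exact hφ v v.2 v.2
  rw [this]

theorem mkE_eq {p : paramSet} {x : X} (hx : mkX p = x) {F : Coef 4} {φ : symPow x.line.1 4}
    (h : ∀ (v : V) (hv : v ∈ x.line.1), (coefForm 4 F : V → ℂ) v = (φ : x.line.1 → ℂ) ⟨v, hv⟩) :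
    mkE (p, F) = ⟨x, Submodule.Quotient.mk φ⟩ :=
  totalSpace_ext hx (symRestrict (mkX p).line.1 4 (coefForm 4 F)) φ fun v _ hv' => h v hv'

theorem mkE_surjective : Function.Surjective mkE := by
  rintro ⟨x, v⟩
  obtain ⟨p, hp⟩ := mkX_surjective x
  obtain ⟨φ, rfl⟩ := Submodule.Quotient.mk_surjective _ v
  obtain ⟨ψ, rfl⟩ := symRestrict_surjective _ 4 φ
  refine ⟨(p, formCoef 4 ψ), mkE_eq hp fun v hv => ?_⟩
  rw [coefForm_formCoef]
  rfl

theorem isQuotientMap_mkX : Topology.IsQuotientMap mkX := ⟨⟨rfl⟩, mkX_surjective⟩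

theorem isQuotientMap_mkE : Topology.IsQuotientMap mkE := ⟨⟨rfl⟩, mkE_surjective⟩

/-! ### The action of `GL₃` on the total space of `E` -/

/-- The map of the total space of `E` induced by `A ∈ GL₃`. -/
def naturalTotalMap (A : GL (Fin 3) ℂ) (y : TotalSpace ModelFibre E) : TotalSpace ModelFibre E :=
  ⟨A • y.1, naturalMap A y.1 y.2⟩

theorem naturalTotalMap_mk (A : GL (Fin 3) ℂ) (x : X) (φ : symPow x.line.1 4) :
    naturalTotalMap A ⟨x, Submodule.Quotient.mk φ⟩ =
      ⟨A • x, Submodule.Quotient.mk (symPullback (transportBack A x.line) 4 φ)⟩ := rfl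

theorem naturalTotalMap_mul (A B : GL (Fin 3) ℂ) (y : TotalSpace ModelFibre E) :
    naturalTotalMap (A * B) y = naturalTotalMap A (naturalTotalMap B y) := by
  obtain ⟨x, v⟩ := y
  obtain ⟨φ, rfl⟩ := Submodule.Quotient.mk_surjective _ v
  refine totalSpace_ext (x := (A * B) • x) (x' := A • B • x) (mul_smul A B x)
    (symPullback (transportBack (A * B) x.line) 4 φ)
    (symPullback (transportBack A (moveLine B x.line)) 4
      (symPullback (transportBack B x.line) 4 φ)) fun v hv hv' => ?_
  refine congrArg (φ : x.line.1 → ℂ) (Subtype.ext ?_)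
  change (glEquiv (A * B)).symm v = (glEquiv B).symm ((glEquiv A).symm v)
  rw [map_mul]
  rfl

theorem glEquiv_scalar_symm (u : ℂˣ) (v : V) :
    (glEquiv (Matrix.GeneralLinearGroup.scalar (Fin 3) u)).symm v = (u : ℂ)⁻¹ • v := by
  rw [LinearEquiv.symm_apply_eq, glEquiv_scalar, smul_smul, mul_inv_cancel₀ u.ne_zero, one_smul]

theorem naturalTotalMap_scalar (u : ℂˣ) (y : TotalSpace ModelFibre E) :
    naturalTotalMap (Matrix.GeneralLinearGroup.scalar (Fin 3) u) y =
      ⟨y.1, ((u : ℂ)⁻¹ ^ 4) • y.2⟩ := by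
  obtain ⟨x, v⟩ := y
  obtain ⟨φ, rfl⟩ := Submodule.Quotient.mk_surjective _ v
  rw [naturalTotalMap_mk, ← Submodule.Quotient.mk_smul]
  refine totalSpace_ext (scalar_smul_X u x) _ _ fun v hv hv' => ?_
  rw [Submodule.coe_smul, Pi.smul_apply, smul_eq_mul, ← symPow_smul 4 φ.2]
  refine congrArg (φ : x.line.1 → ℂ) (Subtype.ext ?_)
  exact glEquiv_scalar_symm u v

theorem naturalTotalMap_scalar_of_pow_eq_one {u : ℂˣ} (hu : (u : ℂ) ^ 4 = 1)
    (y : TotalSpace ModelFibre E) :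
    naturalTotalMap (Matrix.GeneralLinearGroup.scalar (Fin 3) u) y = y := by
  rw [naturalTotalMap_scalar, inv_pow, hu, inv_one, one_smul]

/-- The action of `A` on the coefficients of linear equations of lines. -/
def actVec (A : GL (Fin 3) ℂ) (a : V) : V := fun i => linForm a ((glEquiv A).symm (Pi.single i 1))

theorem linForm_actVec (A : GL (Fin 3) ℂ) (a : V) :
    linForm (actVec A a) = linForm a ∘ₗ (glEquiv A).symm.toLinearMap := by
  refine LinearMap.pi_ext' fun i => LinearMap.ext_ring ?_
  simp [linForm_apply, actVec, Pi.single_apply]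

theorem continuous_actVec (A : GL (Fin 3) ℂ) : Continuous (actVec A) := by
  refine continuous_pi fun i => ?_
  simp only [actVec, linForm_apply]
  fun_prop

/-- The action of `A` on the coefficients of forms. -/
def actCoef (A : GL (Fin 3) ℂ) (d : ℕ) : Coef d →ₗ[ℂ] Coef d :=
  formCoef d ∘ₗ symPullback (glEquiv A).symm.toLinearMap d ∘ₗ coefForm d

theorem coefForm_actCoef (A : GL (Fin 3) ℂ) (d : ℕ) (c : Coef d) :
    coefForm d (actCoef A d c) = symPullback (glEquiv A).symm.toLinearMap d (coefForm d c) := by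
  simp [actCoef]

theorem continuous_actCoef (A : GL (Fin 3) ℂ) (d : ℕ) : Continuous (actCoef A d) :=
  LinearMap.continuous_of_finiteDimensional _

theorem ker_linForm_actVec (A : GL (Fin 3) ℂ) (a : V) :
    LinearMap.ker (linForm (actVec A a)) =
      (LinearMap.ker (linForm a)).map (glEquiv A).toLinearMap := by
  ext v
  rw [linForm_actVec]
  constructor
  · intro hv
    exact ⟨(glEquiv A).symm v, hv, by simp⟩
  · rintro ⟨w, hw, rfl⟩
    simpa using hw

theorem actParam_mem (A : GL (Fin 3) ℂ) {p : V × Coef 2} (hp : p ∈ paramSet) :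
    (actVec A p.1, actCoef A 2 p.2) ∈ paramSet := by
  refine ⟨fun h => hp.1 ?_, fun h => hp.2 ?_⟩
  · have h0 : linForm p.1 = 0 := by
      have h1 := linForm_actVec A p.1
      rw [show actVec A p.1 = 0 from h] at h1
      ext i
      have := LinearMap.congr_fun h1 (glEquiv A (Pi.single i 1))
      simpa [linForm_apply] using this.symm
    funext i
    simpa [linForm_apply, Pi.single_apply] using LinearMap.congr_fun h0 (Pi.single i 1)
  · ext ⟨v, hv⟩
    have hv' : glEquiv A v ∈ LinearMap.ker (linForm (actVec A p.1)) := by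
      rw [ker_linForm_actVec]
      exact ⟨v, hv, rfl⟩
    have := congrFun (congrArg Subtype.val h) ⟨_, hv'⟩
    change (coefForm 2 (actCoef A 2 p.2) : V → ℂ) (glEquiv A v) = 0 at this
    rw [coefForm_actCoef, symPullback_coe, LinearEquiv.coe_coe, LinearEquiv.symm_apply_apply] at this
    exact this

/-- The action of `A` on the parameters of points of `X`. -/
def actParam (A : GL (Fin 3) ℂ) (p : paramSet) : paramSet :=
  ⟨(actVec A p.1.1, actCoef A 2 p.1.2), actParam_mem A p.2⟩

theorem continuous_actParam (A : GL (Fin 3) ℂ) : Continuous (actParam A) := by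
  have h1 := continuous_actVec A
  have h2 := continuous_actCoef A 2
  exact Continuous.subtype_mk (by fun_prop) _

theorem smul_mkX (A : GL (Fin 3) ℂ) (p : paramSet) : A • mkX p = mkX (actParam A p) := by
  refine (mkX_eq (L := moveLine A (mkX p).line) (ker_linForm_actVec A p.1.1) _ fun v hv => ?_).symm
  change (coefForm 2 (actCoef A 2 p.1.2) : V → ℂ) v = _
  rw [coefForm_actCoef]
  rfl

theorem naturalTotalMap_mkE (A : GL (Fin 3) ℂ) (y : paramSet × Coef 4) :
    naturalTotalMap A (mkE y) = mkE (actParam A y.1, actCoef A 4 y.2) := by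
  refine (mkE_eq (smul_mkX A y.1).symm fun v hv => ?_).symm
  rw [coefForm_actCoef]
  rfl

theorem continuous_smul_X (A : GL (Fin 3) ℂ) : Continuous (fun x : X => A • x) := by
  rw [isQuotientMap_mkX.continuous_iff]
  have h : (fun x : X => A • x) ∘ mkX = mkX ∘ actParam A := funext (smul_mkX A)
  rw [h]
  exact isQuotientMap_mkX.continuous.comp (continuous_actParam A)

theorem continuous_naturalTotalMap (A : GL (Fin 3) ℂ) : Continuous (naturalTotalMap A) := by
  rw [isQuotientMap_mkE.continuous_iff]
  have h : naturalTotalMap A ∘ mkE = mkE ∘ fun y => (actParam A y.1, actCoef A 4 y.2) :=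
    funext (naturalTotalMap_mkE A)
  rw [h]
  have h1 := continuous_actParam A
  have h2 := continuous_actCoef A 4
  exact isQuotientMap_mkE.continuous.comp (by fun_prop)

/-- A linearized action from its maps on the fibres, for which the axioms of an action are checked
on the total space. -/
def LinearizedAction.ofTotalMap {Γ : Type} [Group Γ] {B : Type} [MulAction Γ B] {F : Type}
    {E : B → Type} [∀ b, AddCommGroup (E b)] [∀ b, Module ℂ (E b)]
    (act : ∀ (g : Γ) (b : B), E b →ₗ[ℂ] E (g • b)) (m : Γ → TotalSpace F E → TotalSpace F E)
    (h : ∀ g b v, (⟨g • b, act g b v⟩ : TotalSpace F E) = m g ⟨b, v⟩) (hone : ∀ y, m 1 y = y)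
    (hmul : ∀ g g' y, m (g * g') y = m g (m g' y)) : LinearizedAction Γ F E where
  act := act
  one_act b v := by rw [h, hone]
  mul_act g g' b v := by rw [h, h, h, hmul]

/-! ### Natural linearized actions -/

section Group

variable {G : Subgroup PGL(3, ℂ)}

theorem smul_eq_of_mk_eq {g : G} {A : GL (Fin 3) ℂ}
    (h : Matrix.ProjGenLinGroup.mk A = (g : PGL(3, ℂ))) (x : X) : g • x = A • x := by
  change (g : PGL(3, ℂ)) • x = _
  rw [← h]
  rfl

theorem isNatural_iff (ρ : LinearizedAction G ModelFibre E) :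
    IsNatural ρ ↔ ∀ g : G, ∃ A : GL (Fin 3) ℂ,
      Matrix.ProjGenLinGroup.mk A = (g : PGL(3, ℂ)) ∧ ρ.totalMap g = naturalTotalMap A :=
  forall_congr' fun _ => exists_congr fun _ => and_congr_right fun _ =>
    ⟨fun h => funext fun y => h y.1 y.2, fun h x v => congrFun h ⟨x, v⟩⟩

/-- Natural actions are continuous, since `GL₃` acts continuously. -/
theorem IsNatural.isContinuous {ρ : LinearizedAction G ModelFibre E} (hρ : IsNatural ρ) :
    ρ.IsContinuous := by
  intro g
  obtain ⟨A, hA, h⟩ := (isNatural_iff ρ).1 hρ g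
  rw [h]
  refine ⟨?_, continuous_naturalTotalMap A⟩
  rw [show (fun x : X => g • x) = fun x => A • x from funext (smul_eq_of_mk_eq hA)]
  exact continuous_smul_X A

/-- A twist of a natural action is natural: the scalar `χ g` is absorbed into the representative of
`g`, since scalar matrices act on the fibres of `E` by fourth powers. -/
theorem IsNatural.twist {ρ : LinearizedAction G ModelFibre E} (hρ : IsNatural ρ) (χ : G →* ℂˣ) :
    IsNatural (ρ.twist χ) := by
  rw [isNatural_iff] at hρ ⊢
  intro g
  obtain ⟨A, hA, h⟩ := hρ g
  obtain ⟨u, hu⟩ := IsAlgClosed.exists_pow_nat_eq ((χ g : ℂ)⁻¹) (n := 4) (by norm_num)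
  have hu0 : u ≠ 0 := by
    rintro rfl
    exact inv_ne_zero (χ g).ne_zero (by simpa using hu.symm)
  refine ⟨Matrix.GeneralLinearGroup.scalar (Fin 3) (Units.mk0 u hu0) * A, ?_, ?_⟩
  · rw [map_mul, Matrix.ProjGenLinGroup.mk_scalar, one_mul, hA]
  · funext y
    rw [naturalTotalMap_mul, naturalTotalMap_scalar, ← h, Units.val_mk0, inv_pow, hu, inv_inv]
    rfl

/-- The identification of fibres of `E` at equal points. -/
def fibreCast {x x' : X} (h : x = x') : E x ≃ₗ[ℂ] E x' := h ▸ LinearEquiv.refl ℂ (E x)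

theorem mk_fibreCast {x x' : X} (h : x = x') (v : E x) :
    (⟨x', fibreCast h v⟩ : TotalSpace ModelFibre E) = ⟨x, v⟩ := by
  subst h
  rfl

/-- The map of fibres of `E` given by a representative `A` of `g`. -/
def representativeMap {g : G} {A : GL (Fin 3) ℂ}
    (hA : Matrix.ProjGenLinGroup.mk A = (g : PGL(3, ℂ))) (x : X) : E x →ₗ[ℂ] E (g • x) :=
  (fibreCast (smul_eq_of_mk_eq hA x).symm).toLinearMap ∘ₗ naturalMap A x

theorem mk_representativeMap {g : G} {A : GL (Fin 3) ℂ}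
    (hA : Matrix.ProjGenLinGroup.mk A = (g : PGL(3, ℂ))) (x : X) (v : E x) :
    (⟨g • x, representativeMap hA x v⟩ : TotalSpace ModelFibre E) = naturalTotalMap A ⟨x, v⟩ :=
  mk_fibreCast _ _

/-- The linearized action given by representatives in `GL₃` that form a group up to fourth roots of
unity. -/
def linearizedAction (A : G → GL (Fin 3) ℂ)
    (hA : ∀ g, Matrix.ProjGenLinGroup.mk (A g) = (g : PGL(3, ℂ)))
    (hone : ∃ u : ℂˣ, (u : ℂ) ^ 4 = 1 ∧ A 1 = Matrix.GeneralLinearGroup.scalar (Fin 3) u)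
    (hmul : ∀ g h, ∃ u : ℂˣ, (u : ℂ) ^ 4 = 1 ∧
      A (g * h) = Matrix.GeneralLinearGroup.scalar (Fin 3) u * (A g * A h)) :
    LinearizedAction G ModelFibre E :=
  LinearizedAction.ofTotalMap (fun g x => representativeMap (hA g) x)
    (fun g => naturalTotalMap (A g)) (fun g => mk_representativeMap (hA g))
    (fun y => by
      obtain ⟨u, hu, h1⟩ := hone
      rw [h1, naturalTotalMap_scalar_of_pow_eq_one hu])
    (fun g h y => by
      obtain ⟨u, hu, h1⟩ := hmul g h
      rw [h1, naturalTotalMap_mul, naturalTotalMap_scalar_of_pow_eq_one hu, naturalTotalMap_mul])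

theorem totalMap_linearizedAction {A : G → GL (Fin 3) ℂ} (hA) (hone) (hmul) (g : G) :
    (linearizedAction A hA hone hmul).totalMap g = naturalTotalMap (A g) :=
  funext fun y => mk_representativeMap (hA g) y.1 y.2

end Group

/-! ### The character of an invariant quartic -/

namespace PlaneQuartic

theorem eval_linSubst (A : GL (Fin 3) ℂ) (v : V) (f : MvPolynomial (Fin 3) ℂ) :
    MvPolynomial.eval v (linSubst A f) = MvPolynomial.eval (glEquiv A v) f := by
  have h : (MvPolynomial.aeval v).comp (linSubst A) =
      (MvPolynomial.aeval (glEquiv A v) : MvPolynomial (Fin 3) ℂ →ₐ[ℂ] ℂ) := by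
    apply MvPolynomial.algHom_ext
    intro i
    simp [linSubst, glEquiv_apply, Matrix.mulVec, dotProduct]
  simpa [MvPolynomial.coe_aeval_eq_eval] using DFunLike.congr_fun h f

variable {C : PlaneQuartic}

/-- An element of `GL₃` that preserves the ideal of `C` multiplies the equation by a scalar. -/
theorem exists_scalar_of_mem_linStabilizer {A : GL (Fin 3) ℂ} (hA : A ∈ C.linStabilizer) :
    ∃ c : ℂ, c ≠ 0 ∧ ∀ v : V, MvPolynomial.eval (glEquiv A v) C.form =
      c * MvPolynomial.eval v C.form := by
  have hA' : Ideal.map (linSubst A) (Ideal.span {C.form}) = Ideal.span {C.form} := hA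
  rw [Ideal.map_span, Set.image_singleton, Ideal.span_singleton_eq_span_singleton] at hA'
  obtain ⟨u, hu⟩ := hA'.symm
  obtain ⟨c, hc, hcu⟩ := MvPolynomial.isUnit_iff_eq_C_of_isReduced.1 u.isUnit
  refine ⟨c, hc.ne_zero, fun v => ?_⟩
  have := congrArg (MvPolynomial.eval v) hu
  rw [map_mul, hcu, MvPolynomial.eval_C] at this
  rw [← eval_linSubst]
  exact this.symm.trans (mul_comm _ _)

theorem eval_smul (u : ℂ) (v : V) :
    MvPolynomial.eval (u • v) C.form = u ^ 4 * MvPolynomial.eval v C.form :=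
  symPow_smul 4 C.eval_form_mem u v

/-- Rescaling by a fourth root, each automorphism of `C` is represented by a matrix that fixes the
equation of `C`. -/
theorem exists_representative {g : PGL(3, ℂ)} (hg : g ∈ C.aut) :
    ∃ A : GL (Fin 3) ℂ, Matrix.ProjGenLinGroup.mk A = g ∧
      ∀ v : V, MvPolynomial.eval (glEquiv A v) C.form = MvPolynomial.eval v C.form := by
  obtain ⟨B, hB, rfl⟩ := hg
  obtain ⟨c, hc, h⟩ := exists_scalar_of_mem_linStabilizer hB
  obtain ⟨u, hu⟩ := IsAlgClosed.exists_pow_nat_eq c⁻¹ (n := 4) (by norm_num)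
  have hu0 : u ≠ 0 := by
    rintro rfl
    exact inv_ne_zero hc (by simpa using hu.symm)
  refine ⟨Matrix.GeneralLinearGroup.scalar (Fin 3) (Units.mk0 u hu0) * B, ?_, fun v => ?_⟩
  · rw [map_mul, Matrix.ProjGenLinGroup.mk_scalar, one_mul]
  · rw [map_mul]
    change MvPolynomial.eval (glEquiv _ (glEquiv B v)) C.form = _
    rw [glEquiv_scalar, eval_smul, h, Units.val_mk0, hu, inv_mul_cancel_left₀ hc]

theorem exists_scalar_of_mk_mem_aut {A : GL (Fin 3) ℂ}
    (hA : Matrix.ProjGenLinGroup.mk A ∈ C.aut) :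
    ∃ c : ℂ, c ≠ 0 ∧ ∀ v : V, MvPolynomial.eval (glEquiv A v) C.form =
      c * MvPolynomial.eval v C.form := by
  obtain ⟨B, hB, h⟩ := exists_representative hA
  obtain ⟨u, rfl⟩ := Matrix.ProjGenLinGroup.mk_eq_mk_iff.1 hB
  refine ⟨(u : ℂ) ^ 4, pow_ne_zero _ u.ne_zero, fun v => ?_⟩
  rw [map_mul]
  change MvPolynomial.eval (glEquiv B (glEquiv _ v)) C.form = _
  rw [h, glEquiv_scalar, eval_smul]

theorem exists_eval_ne_zero (C : PlaneQuartic) : ∃ v : V, MvPolynomial.eval v C.form ≠ 0 := by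
  by_contra! h
  exact C.ne_zero (MvPolynomial.funext fun v => by rw [h v, map_zero])

/-- If two matrices that fix the equation of `C` represent the same projective transformation, then
they differ by a fourth root of unity. -/
theorem exists_scalar_mul_eq {A B : GL (Fin 3) ℂ}
    (h : Matrix.ProjGenLinGroup.mk A = Matrix.ProjGenLinGroup.mk B)
    (hA : ∀ v : V, MvPolynomial.eval (glEquiv A v) C.form = MvPolynomial.eval v C.form)
    (hB : ∀ v : V, MvPolynomial.eval (glEquiv B v) C.form = MvPolynomial.eval v C.form) :
    ∃ u : ℂˣ, (u : ℂ) ^ 4 = 1 ∧ A = Matrix.GeneralLinearGroup.scalar (Fin 3) u * B := by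
  obtain ⟨u, hu⟩ := Matrix.ProjGenLinGroup.mk_eq_mk_iff.1 h.symm
  have hcomm : A = Matrix.GeneralLinearGroup.scalar (Fin 3) u * B := by
    rw [← hu]
    ext i j
    simp [Matrix.scalar_apply, mul_comm]
  refine ⟨u, ?_, hcomm⟩
  obtain ⟨v, hv⟩ := C.exists_eval_ne_zero
  have h1 := hA v
  rw [hcomm, map_mul] at h1
  change MvPolynomial.eval (glEquiv _ (glEquiv B v)) C.form = _ at h1
  rw [glEquiv_scalar, eval_smul, hB] at h1
  exact mul_right_cancel₀ hv (h1.trans (one_mul _).symm)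

variable {G : Subgroup PGL(3, ℂ)}

/-- The automorphisms of a quartic act naturally on `E`, through the matrices that fix the equation
of the quartic. Every quartic that they preserve has a character. -/
theorem exists_natural_action (C₀ : PlaneQuartic) (hG : G ≤ C₀.aut) :
    ∃ ρ : LinearizedAction G ModelFibre E, IsNatural ρ ∧ ∀ C : PlaneQuartic, G ≤ C.aut →
      ∃ χ : G →* ℂˣ, (ρ.twist χ).IsEquivariantSection C.inducedSection := by
  choose A hA hA' using fun g : G => exists_representative (hG g.2)
  have hfix (g h : G) (v : V) :
      MvPolynomial.eval (glEquiv (A g * A h) v) C₀.form = MvPolynomial.eval v C₀.form := by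
    rw [map_mul]
    exact (hA' g _).trans (hA' h v)
  have hmul (g h : G) : ∃ u : ℂˣ, (u : ℂ) ^ 4 = 1 ∧
      A (g * h) = Matrix.GeneralLinearGroup.scalar (Fin 3) u * (A g * A h) :=
    exists_scalar_mul_eq (by rw [hA, map_mul, hA, hA]; rfl) (hA' _) (hfix g h)
  have hone : ∃ u : ℂˣ, (u : ℂ) ^ 4 = 1 ∧ A 1 = Matrix.GeneralLinearGroup.scalar (Fin 3) u := by
    obtain ⟨u, hu, h⟩ := exists_scalar_mul_eq (B := 1) (by rw [hA, map_one]; rfl) (hA' 1)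
      (fun v => by rw [map_one]; rfl)
    exact ⟨u, hu, by rw [h, mul_one]⟩
  refine ⟨linearizedAction A hA hone hmul, (isNatural_iff _).2 fun g =>
    ⟨A g, hA g, totalMap_linearizedAction hA hone hmul g⟩, fun C hC => ?_⟩
  choose c hc hc' using fun g : G => exists_scalar_of_mk_mem_aut (C := C) (A := A g)
    (by rw [hA]; exact hC g.2)
  obtain ⟨v₀, hv₀⟩ := C.exists_eval_ne_zero
  have hcmul (g h : G) : c (g * h) = c g * c h := by
    obtain ⟨u, hu, h1⟩ := hmul g h
    have h2 := hc' (g * h) v₀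
    rw [h1, map_mul, map_mul] at h2
    change MvPolynomial.eval (glEquiv _ (glEquiv (A g) (glEquiv (A h) v₀))) C.form = _ at h2
    rw [glEquiv_scalar, eval_smul, hu, one_mul, hc', hc', ← mul_assoc] at h2
    exact (mul_right_cancel₀ hv₀ h2).symm
  have hcone : c 1 = 1 := mul_left_cancel₀ (hc 1) (by rw [← hcmul, mul_one, mul_one])
  refine ⟨⟨⟨fun g => Units.mk0 (c g) (hc g), Units.ext hcone⟩,
    fun g h => Units.ext (hcmul g h)⟩, fun g x => ?_⟩
  refine TotalSpace.mk_injective (F := ModelFibre) (g • x) ?_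
  change (⟨g • x, c g • (linearizedAction A hA hone hmul).act g x (C.inducedSection x)⟩ :
    TotalSpace ModelFibre E) = _
  refine (LinearizedAction.mk_smul_eq (c g) (congrFun (totalMap_linearizedAction hA hone hmul g)
    ⟨x, C.inducedSection x⟩)).trans ?_
  change (⟨_, c g • Submodule.Quotient.mk (symPullback _ 4 (symRestrict x.line.1 4 C.toSym))⟩ :
    TotalSpace ModelFibre E) = _
  rw [← Submodule.Quotient.mk_smul]
  refine totalSpace_ext (smul_eq_of_mk_eq (hA g) x).symm _ _ fun v hv hv' => ?_
  change c g * MvPolynomial.eval ((glEquiv (A g)).symm v) C.form = MvPolynomial.eval v C.form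
  rw [← hc', LinearEquiv.apply_symm_apply]

end PlaneQuartic

/-! ### Interpolation of forms -/

theorem prod_mem_symPow {M ι : Type} [AddCommGroup M] [Module ℂ M] (s : Finset ι)
    (T : ι → M →ₗ[ℂ] ℂ) : (∏ i ∈ s, ⇑(T i) : M → ℂ) ∈ symPow M s.card := by
  classical
  induction s using Finset.induction_on with
  | empty => exact Submodule.one_le.1 le_rfl
  | insert i s hi ih =>
    rw [Finset.prod_insert hi, Finset.card_insert_of_notMem hi, add_comm]
    exact mul_mem_symPow (linearMap_mem_symPow _) ih

/-- The form of degree `d` in the last two coordinates of a basis that vanishes at the `d` points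
`(k : 1)` and takes the value `1` at `(1 : 0)`. -/
def nodeForm (b : Module.Basis (Fin 3) ℂ V) (d : ℕ) : symPow V d :=
  ⟨∏ j : Fin d, ⇑(b.coord 1 - (j : ℂ) • b.coord 2), by
    simpa using prod_mem_symPow (Finset.univ : Finset (Fin d))
      fun j => b.coord 1 - (j : ℂ) • b.coord 2⟩

/-- The form of degree `d` in the last two coordinates of a basis that takes the value `1` at
`(k : 1)` and vanishes at `(1 : 0)` and at the other points `(j : 1)` with `j < d`. -/
def lagrangeForm (b : Module.Basis (Fin 3) ℂ V) (d : ℕ) (k : Fin d) : symPow V d :=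
  ⟨⇑(b.coord 2) * ∏ j ∈ Finset.univ.erase k,
      ⇑(((k : ℂ) - j)⁻¹ • (b.coord 1 - (j : ℂ) • b.coord 2)), by
    have h := mul_mem_symPow (linearMap_mem_symPow (b.coord 2))
      (prod_mem_symPow (Finset.univ.erase k)
        fun j => ((k : ℂ) - j)⁻¹ • (b.coord 1 - (j : ℂ) • b.coord 2))
    have hd : 1 + (Finset.univ.erase k).card = d := by
      rw [Finset.card_erase_of_mem (Finset.mem_univ k), Finset.card_univ, Fintype.card_fin]
      have := k.2
      omega
    rwa [hd] at h⟩

section Interpolation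

variable (b : Module.Basis (Fin 3) ℂ V) {d : ℕ} {x : V}

theorem nodeForm_apply_of_coord (h1 : b.coord 1 x = 1) (h2 : b.coord 2 x = 0) :
    (nodeForm b d : V → ℂ) x = 1 := by
  simp only [nodeForm, Finset.prod_apply, LinearMap.sub_apply, LinearMap.smul_apply, h1, h2]
  simp

theorem nodeForm_apply_of_coord' {k : ℕ} (hk : k < d) (h1 : b.coord 1 x = k)
    (h2 : b.coord 2 x = 1) : (nodeForm b d : V → ℂ) x = 0 := by
  simp only [nodeForm, Finset.prod_apply, LinearMap.sub_apply, LinearMap.smul_apply, h1, h2]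
  exact Finset.prod_eq_zero (Finset.mem_univ ⟨k, hk⟩) (by simp)

theorem lagrangeForm_apply_of_coord (k : Fin d) (h2 : b.coord 2 x = 0) :
    (lagrangeForm b d k : V → ℂ) x = 0 := by
  simp only [lagrangeForm, Pi.mul_apply, h2, zero_mul]

theorem lagrangeForm_apply_of_coord' (k : Fin d) {m : ℕ} (hm : m < d) (h1 : b.coord 1 x = m)
    (h2 : b.coord 2 x = 1) : (lagrangeForm b d k : V → ℂ) x = if (k : ℕ) = m then 1 else 0 := by
  simp only [lagrangeForm, Pi.mul_apply, Finset.prod_apply, LinearMap.sub_apply,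
    LinearMap.smul_apply, h1, h2, smul_eq_mul, mul_one, one_mul]
  split_ifs with h
  · refine Finset.prod_eq_one fun j hj => ?_
    rw [← h]
    refine inv_mul_cancel₀ (sub_ne_zero.2 fun h' => Finset.ne_of_mem_erase hj ?_)
    exact Fin.ext (Nat.cast_injective h').symm
  · refine Finset.prod_eq_zero (i := ⟨m, hm⟩) (Finset.mem_erase.2 ⟨?_, Finset.mem_univ _⟩) (by simp)
    exact fun h' => h (congrArg Fin.val h').symm

end Interpolation

/-! ### Projection to a line -/

/-- The projection of `V` to the line `L` from the point `w`. It is zero if `w` lies on `L`. -/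
def lineProj (w : V) (L : DualPlane) : V →ₗ[ℂ] L.1 :=
  (linForm (exists_line_equation L).choose w)⁻¹ •
    LinearMap.codRestrict L.1 (linForm (exists_line_equation L).choose w • LinearMap.id -
      (linForm (exists_line_equation L).choose).smulRight w) (fun v => by
        refine (SetLike.ext_iff.1 (exists_line_equation L).choose_spec.2 _).1 ?_
        rw [LinearMap.mem_ker]
        simp [mul_comm])

/-- The projection along `w` to the line with equation `a`, as a function of `a`. -/
def paramProj (w a y : V) : V := y - (linForm a y / linForm a w) • w

theorem coe_lineProj {w a : V} {L : DualPlane} (ha : LinearMap.ker (linForm a) = L.1)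
    (hw : w ∉ L.1) (y : V) : (lineProj w L y : V) = paramProj w a y := by
  obtain ⟨a', ha', h⟩ : ∃ a', LinearMap.ker (linForm a') = L.1 ∧ (lineProj w L y : V) =
      (linForm a' w)⁻¹ • (linForm a' w • y - linForm a' y • w) :=
    ⟨_, (exists_line_equation L).choose_spec.2, rfl⟩
  have h0 : linForm a w ≠ 0 := fun h => hw (by rw [← ha]; exact h)
  have h0' : linForm a' w ≠ 0 := fun h => hw (by rw [← ha']; exact h)
  have hmem : paramProj w a y ∈ LinearMap.ker (linForm a') := by
    rw [ha', ← ha, LinearMap.mem_ker, paramProj, map_sub, map_smul, smul_eq_mul,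
      div_mul_cancel₀ _ h0, sub_self]
  rw [LinearMap.mem_ker, paramProj, map_sub, map_smul, smul_eq_mul, sub_eq_zero] at hmem
  rw [h, smul_sub, smul_smul, smul_smul, inv_mul_cancel₀ h0', one_smul, paramProj, hmem,
    mul_comm (linForm a y / _), inv_mul_cancel_left₀ h0']

theorem exists_coe_lineProj {w : V} {L : DualPlane} (hw : w ∉ L.1) (y : V) :
    ∃ c : ℂ, (lineProj w L y : V) = y - c • w := by
  obtain ⟨a, -, ha⟩ := exists_line_equation L
  exact ⟨_, coe_lineProj ha hw y⟩

theorem lineProj_of_mem {w : V} {L : DualPlane} (hw : w ∉ L.1) {y : V} (hy : y ∈ L.1) :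
    lineProj w L y = ⟨y, hy⟩ := by
  obtain ⟨c, hc⟩ := exists_coe_lineProj hw y
  have hcw : c • w ∈ L.1 := by
    have := L.1.sub_mem hy (lineProj w L y).2
    rwa [hc, sub_sub_cancel] at this
  have hc0 : c = 0 := by
    by_contra h
    exact hw ((L.1.smul_mem_iff h).1 hcw)
  exact Subtype.ext (by rw [hc, hc0, zero_smul, sub_zero])

theorem lineProj_self {w : V} {L : DualPlane} (hw : w ∉ L.1) : lineProj w L w = 0 := by
  obtain ⟨a, -, ha⟩ := exists_line_equation L
  have h0 : linForm a w ≠ 0 := fun h => hw (by rw [← ha]; exact h)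
  refine Subtype.ext ?_
  rw [coe_lineProj ha hw, paramProj, div_self h0, one_smul, sub_self]
  rfl

section Frame

variable (b : Module.Basis (Fin 3) ℂ V)

/-- The projection of `b 1` to the line `L` from the point `b 0`. It is the point `(1 : 0)` of `L` in
the last two coordinates of the basis. -/
def framePoint (L : DualPlane) : L.1 := lineProj (b 0) L (b 1)

/-- The projection of `b 2 + k • b 1` to the line `L` from the point `b 0`. It is the point `(k : 1)`
of `L` in the last two coordinates of the basis. -/
def frameNode (L : DualPlane) (k : ℕ) : L.1 := lineProj (b 0) L (b 2 + (k : ℂ) • b 1)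

variable {b} {L : DualPlane}

theorem frameNode_eq (k : ℕ) : frameNode b L k = lineProj (b 0) L (b 2) + (k : ℂ) • framePoint b L := by
  simp [frameNode, framePoint]

theorem coord_lineProj (hL : b 0 ∉ L.1) {i : Fin 3} (hi : i ≠ 0) (y : V) :
    b.coord i (lineProj (b 0) L y) = b.coord i y := by
  obtain ⟨c, hc⟩ := exists_coe_lineProj hL y
  rw [hc, map_sub, map_smul]
  simp [hi.symm]

theorem coord_framePoint_one (hL : b 0 ∉ L.1) : b.coord 1 (framePoint b L) = 1 := by
  rw [framePoint, coord_lineProj hL (by decide)]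
  simp

theorem coord_framePoint_two (hL : b 0 ∉ L.1) : b.coord 2 (framePoint b L) = 0 := by
  rw [framePoint, coord_lineProj hL (by decide)]
  simp

theorem coord_frameNode_one (hL : b 0 ∉ L.1) (k : ℕ) : b.coord 1 (frameNode b L k) = k := by
  rw [frameNode, coord_lineProj hL (by decide)]
  simp

theorem coord_frameNode_two (hL : b 0 ∉ L.1) (k : ℕ) : b.coord 2 (frameNode b L k) = 1 := by
  rw [frameNode, coord_lineProj hL (by decide)]
  simp

/-- A form of degree `d` on `L` is determined by its values at `d + 1` points. -/
theorem eq_of_apply_frame_eq (hL : b 0 ∉ L.1) {d : ℕ} {φ ψ : L.1 → ℂ} (hφ : φ ∈ symPow L.1 d)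
    (hψ : ψ ∈ symPow L.1 d) (h : φ (framePoint b L) = ψ (framePoint b L))
    (h' : ∀ k < d, φ (frameNode b L k) = ψ (frameNode b L k)) : φ = ψ := by
  refine sub_eq_zero.1 (eq_zero_of_vanishing_at (u := framePoint b L) (v := lineProj (b 0) L (b 2))
    (fun x => ⟨b.coord 1 x, b.coord 2 x, ?_⟩) (sub_mem hφ hψ) (sub_eq_zero.2 h) fun k hk => ?_)
  · have hx := congrArg (lineProj (b 0) L) (b.sum_repr (x : V))
    rw [lineProj_of_mem hL x.2, Fin.sum_univ_three, map_add, map_add, map_smul, map_smul, map_smul,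
      lineProj_self hL, smul_zero, zero_add] at hx
    exact hx.symm
  · rw [← frameNode_eq]
    exact sub_eq_zero.2 (h' k hk)

end Frame

/-! ### Coordinates on the fibres of `E` -/

/-- The quotient of the values of an equation of `Z` at two points of `L`. -/
def schemeRatio (x : X) (u p : x.line.1) : ℂ :=
  (x.scheme.rep : x.line.1 → ℂ) p / (x.scheme.rep : x.line.1 → ℂ) u

theorem schemeRatio_eq {x : X} {q : symPow x.line.1 2} (hq : q ≠ 0)
    (h : x.scheme = Projectivization.mk ℂ q hq) (u p : x.line.1) :
    schemeRatio x u p = (q : x.line.1 → ℂ) p / (q : x.line.1 → ℂ) u := by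
  have h' : Projectivization.mk ℂ x.scheme.rep x.scheme.rep_nonzero = Projectivization.mk ℂ q hq :=
    x.scheme.mk_rep.trans h
  obtain ⟨a, ha⟩ := (Projectivization.mk_eq_mk_iff _ _ _ _ _).1 h'
  rw [schemeRatio, ← ha]
  exact mul_div_mul_left _ _ a.ne_zero

/-- Evaluation of forms at a point. -/
def evalForm {M : Type} [AddCommGroup M] [Module ℂ M] (d : ℕ) (p : M) : symPow M d →ₗ[ℂ] ℂ :=
  LinearMap.proj p ∘ₗ (symPow M d).subtype

theorem evalForm_apply {M : Type} [AddCommGroup M] [Module ℂ M] (d : ℕ) (p : M) (φ : symPow M d) :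
    evalForm d p φ = (φ : M → ℂ) p := rfl

section FibreCoord

variable (b : Module.Basis (Fin 3) ℂ V)

/-- The open set of pairs `(L, Z)` such that `L` does not contain the point `b 0`, and the
projection of the point `b 1` to `L` from `b 0` does not lie in `Z`. -/
def frameSet : Set X := {x | b 0 ∉ x.line.1 ∧ ¬ MemScheme x (framePoint b x.line)}

/-- The coordinates of the class of a quartic form `φ` on `L`: the values at four points of the
unique form `φ - c • q ^ 2` that vanishes at the point `framePoint b L`, where `q` is an equation of
`Z`. The factor `schemeRatio x u u` is `1` if `u` does not lie in `Z`, and `0` otherwise, so that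
the coordinates are well defined in both cases. -/
def fibreCoord (x : X) : E x →ₗ[ℂ] ModelFibre :=
  (tautSqFibre x).liftQ (LinearMap.pi fun k : Fin 4 =>
    schemeRatio x (framePoint b x.line) (framePoint b x.line) ^ 2 •
        evalForm 4 (frameNode b x.line k) -
      schemeRatio x (framePoint b x.line) (frameNode b x.line k) ^ 2 •
        evalForm 4 (framePoint b x.line)) (by
    intro φ hφ
    obtain ⟨c, hc⟩ := (mem_tautSqFibre_iff x.scheme.rep_nonzero x.scheme.mk_rep.symm).1 hφ
    rw [LinearMap.mem_ker]
    funext k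
    simp only [LinearMap.pi_apply, LinearMap.sub_apply, LinearMap.smul_apply, evalForm_apply, hc,
      schemeRatio, Pi.smul_apply, Pi.pow_apply, smul_eq_mul, Pi.zero_apply]
    ring)

variable {b}

theorem fibreCoord_mk {x : X} {q : symPow x.line.1 2} (hq : q ≠ 0)
    (h : x.scheme = Projectivization.mk ℂ q hq) (hx : x ∈ frameSet b) (φ : symPow x.line.1 4)
    (k : Fin 4) : fibreCoord b x (Submodule.Quotient.mk φ) k =
      (φ : x.line.1 → ℂ) (frameNode b x.line k) -
        ((q : x.line.1 → ℂ) (frameNode b x.line k) / (q : x.line.1 → ℂ) (framePoint b x.line)) ^ 2 *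
          (φ : x.line.1 → ℂ) (framePoint b x.line) := by
  have hu : (q : x.line.1 → ℂ) (framePoint b x.line) ≠ 0 := fun h' =>
    hx.2 ((memScheme_iff hq h).2 h')
  change schemeRatio x _ _ ^ 2 * _ - schemeRatio x _ _ ^ 2 * _ = _
  rw [schemeRatio_eq hq h, schemeRatio_eq hq h, div_self hu, one_pow, one_mul]
  rfl

theorem fibreCoord_injective {x : X} (hx : x ∈ frameSet b) : Function.Injective (fibreCoord b x) := by
  rw [← LinearMap.ker_eq_bot, LinearMap.ker_eq_bot']
  intro y hy
  obtain ⟨φ, rfl⟩ := Submodule.Quotient.mk_surjective _ y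
  obtain ⟨q, hq, h⟩ : ∃ q hq, x.scheme = Projectivization.mk ℂ q hq :=
    ⟨_, x.scheme.rep_nonzero, x.scheme.mk_rep.symm⟩
  have hu : (q : x.line.1 → ℂ) (framePoint b x.line) ≠ 0 := fun h' =>
    hx.2 ((memScheme_iff hq h).2 h')
  refine (Submodule.Quotient.mk_eq_zero _).2 ((mem_tautSqFibre_iff hq h).2
    ⟨(φ : x.line.1 → ℂ) (framePoint b x.line) / (q : x.line.1 → ℂ) (framePoint b x.line) ^ 2,
      eq_of_apply_frame_eq (b := b) hx.1 φ.2 (Submodule.smul_mem _ _ (pow_mem_symPow q.2 2)) ?_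
        fun k hk => ?_⟩)
  · simp [hu]
  · have := congrFun hy ⟨k, hk⟩
    rw [fibreCoord_mk hq h hx] at this
    rw [sub_eq_zero.1 this]
    simp only [Pi.smul_apply, Pi.pow_apply, smul_eq_mul]
    ring

variable (b) in
/-- The quartic form in the last two coordinates with given values at the points `(k : 1)`, which
vanishes at `(1 : 0)`. -/
def interpolate : ModelFibre →ₗ[ℂ] symPow V 4 :=
  ∑ k : Fin 4, (LinearMap.proj k : ModelFibre →ₗ[ℂ] ℂ).smulRight (lagrangeForm b 4 k)

theorem interpolate_apply (z : ModelFibre) (v : V) :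
    (interpolate b z : V → ℂ) v = ∑ k, z k * (lagrangeForm b 4 k : V → ℂ) v := by
  simp [interpolate]

theorem fibreCoord_interpolate {x : X} (hx : x ∈ frameSet b) (z : ModelFibre) :
    fibreCoord b x (Submodule.Quotient.mk (symRestrict x.line.1 4 (interpolate b z))) = z := by
  obtain ⟨q, hq, h⟩ : ∃ q hq, x.scheme = Projectivization.mk ℂ q hq :=
    ⟨_, x.scheme.rep_nonzero, x.scheme.mk_rep.symm⟩
  funext k
  rw [fibreCoord_mk hq h hx]
  change (interpolate b z : V → ℂ) (frameNode b x.line k) -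
    _ * (interpolate b z : V → ℂ) (framePoint b x.line) = _
  rw [interpolate_apply, interpolate_apply]
  have h1 (j : Fin 4) := lagrangeForm_apply_of_coord b j (coord_framePoint_two hx.1)
  have h2 (j : Fin 4) := lagrangeForm_apply_of_coord' b j k.2 (coord_frameNode_one hx.1 k)
    (coord_frameNode_two hx.1 k)
  simp only [h1, h2, Fin.val_inj]
  simp

theorem mk_interpolate_fibreCoord {x : X} (hx : x ∈ frameSet b) (y : E x) :
    Submodule.Quotient.mk (symRestrict x.line.1 4 (interpolate b (fibreCoord b x y))) = y :=
  fibreCoord_injective hx (fibreCoord_interpolate hx _)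

/-- For every point of `X` there is a basis that gives coordinates near that point. -/
theorem exists_mem_frameSet (x : X) : ∃ b, x ∈ frameSet b := by
  obtain ⟨q, hq, h⟩ : ∃ q hq, x.scheme = Projectivization.mk ℂ q hq :=
    ⟨_, x.scheme.rep_nonzero, x.scheme.mk_rep.symm⟩
  obtain ⟨u, hu⟩ : ∃ u, (q : x.line.1 → ℂ) u ≠ 0 := Function.ne_iff.1 fun h0 => hq (Subtype.ext h0)
  have hu0 : u ≠ 0 := by
    rintro rfl
    have := symPow_smul 2 q.2 0 0
    rw [smul_zero] at this
    exact hu (by simpa using this)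
  obtain ⟨T, hT, hTu⟩ := exists_equation x.line.2 hu0
  obtain ⟨v, hv⟩ := LinearMap.surjective hT 1
  obtain ⟨w, hw⟩ : ∃ w, w ∉ x.line.1 := by
    by_contra! hall
    have h2 := x.line.2
    rw [Submodule.eq_top_iff'.2 hall, finrank_top, Module.finrank_fin_fun] at h2
    omega
  have huv : LinearIndependent ℂ ![(u : V), (v : V)] := by
    have := linearIndependent_pair_of_equation hu0 ((hTu u).2 ⟨1, by simp⟩)
      (show T v ≠ 0 by simp [hv])
    rw [LinearIndependent.pair_iff] at this ⊢
    exact fun s t hst => this s t (Subtype.ext hst)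
  have hli : LinearIndependent ℂ ![w, (u : V), (v : V)] := by
    refine linearIndependent_finCons.2 ⟨huv, fun hmem => hw ?_⟩
    refine Submodule.span_le.2 ?_ hmem
    rintro _ ⟨i, rfl⟩
    fin_cases i
    exacts [u.2, v.2]
  let b := basisOfLinearIndependentOfCardEqFinrank hli (by simp)
  have hb : ⇑b = ![w, (u : V), (v : V)] := coe_basisOfLinearIndependentOfCardEqFinrank hli _
  have hb0 : b 0 = w := congrFun hb 0
  have hb1 : b 1 = u := congrFun hb 1
  refine ⟨b, by rwa [hb0], fun hmem => hu ?_⟩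
  rw [memScheme_iff hq h, framePoint, hb0, hb1, lineProj_of_mem hw u.2] at hmem
  exact hmem

end FibreCoord

/-! ### Coordinates in terms of the parameters -/

theorem differentiable_coefForm (d : ℕ) :
    Differentiable ℂ (fun y : Coef d × V => (coefForm d y.1 : V → ℂ) y.2) := by
  simp only [coefForm_apply]
  fun_prop

theorem differentiable_linForm (v : V) : Differentiable ℂ (fun a : V => linForm a v) := by
  simp only [linForm_apply]
  fun_prop

theorem differentiableOn_div {W : Type} [NormedAddCommGroup W] [NormedSpace ℂ W] {f g : W → ℂ}
    {s : Set W} (hf : DifferentiableOn ℂ f s) (hg : DifferentiableOn ℂ g s)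
    (h : ∀ z ∈ s, g z ≠ 0) : DifferentiableOn ℂ (fun z => f z / g z) s := by
  simp only [div_eq_mul_inv]
  exact hf.fun_mul (hg.fun_inv h)

section Param

variable (b : Module.Basis (Fin 3) ℂ V)

/-- The parameters of the points of `frameSet b`. -/
def paramFrameSet : Set (V × Coef 2) :=
  {p | linForm p.1 (b 0) ≠ 0 ∧ (coefForm 2 p.2 : V → ℂ) (paramProj (b 0) p.1 (b 1)) ≠ 0}

variable {b}

theorem mkX_scheme (p : paramSet) : (mkX p).scheme = Projectivization.mk ℂ
    (symRestrict (mkX p).line.1 2 (coefForm 2 p.1.2)) p.2.2 := rfl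

theorem notMem_mkX_line_iff {p : paramSet} {w : V} :
    w ∉ (mkX p).line.1 ↔ linForm p.1.1 w ≠ 0 := Iff.rfl

theorem coe_lineProj_mkX {p : paramSet} {w : V} (hw : w ∉ (mkX p).line.1) (y : V) :
    (lineProj w (mkX p).line y : V) = paramProj w p.1.1 y := coe_lineProj rfl hw y

theorem mkX_mem_frameSet_iff {p : paramSet} : mkX p ∈ frameSet b ↔ p.1 ∈ paramFrameSet b := by
  refine and_congr_right fun hw => not_congr ?_
  rw [memScheme_iff p.2.2 (mkX_scheme p), ← coe_lineProj_mkX (notMem_mkX_line_iff.2 hw)]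
  rfl

theorem differentiableOn_paramProj (y : V) :
    DifferentiableOn ℂ (fun p : V × Coef 2 => paramProj (b 0) p.1 y) {p | linForm p.1 (b 0) ≠ 0} := by
  intro p hp
  have h1 := differentiable_linForm y
  have h2 := differentiable_linForm (b 0)
  have hp' : linForm p.1 (b 0) ≠ 0 := hp
  unfold paramProj
  fun_prop (disch := exact hp')

theorem differentiableOn_coefForm_paramProj {d : ℕ} {W : Type} [NormedAddCommGroup W]
    [NormedSpace ℂ W] {s : Set W} {c : W → Coef d} {p : W → V × Coef 2}
    (hc : DifferentiableOn ℂ c s) (hp : DifferentiableOn ℂ p s)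
    (hs : ∀ z ∈ s, p z ∈ paramFrameSet b) (y : V) :
    DifferentiableOn ℂ (fun z => (coefForm d (c z) : V → ℂ) (paramProj (b 0) (p z).1 y)) s :=
  (differentiable_coefForm d).comp_differentiableOn
    (hc.prodMk ((differentiableOn_paramProj y).comp hp fun z hz => (hs z hz).1))

theorem isOpen_paramFrameSet : IsOpen (paramFrameSet b) := by
  have h1 : IsOpen {p : V × Coef 2 | linForm p.1 (b 0) ≠ 0} :=
    isOpen_ne_fun ((differentiable_linForm (b 0)).continuous.comp continuous_fst) continuous_const
  have h2 : ContinuousOn (fun p : V × Coef 2 =>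
      (coefForm 2 p.2 : V → ℂ) (paramProj (b 0) p.1 (b 1))) {p | linForm p.1 (b 0) ≠ 0} :=
    (differentiable_coefForm 2).continuous.comp_continuousOn
      (continuousOn_snd.prodMk (differentiableOn_paramProj (b 1)).continuousOn)
  exact h2.isOpen_inter_preimage h1 isOpen_ne

theorem isOpen_frameSet : IsOpen (frameSet b) := by
  rw [← isQuotientMap_mkX.isOpen_preimage]
  have : mkX ⁻¹' frameSet b = Subtype.val ⁻¹' paramFrameSet b :=
    Set.ext fun p => mkX_mem_frameSet_iff
  rw [this]
  exact isOpen_paramFrameSet.preimage continuous_subtype_val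

variable (b) in
/-- The coordinates on the fibres of `E` as functions of the parameters `(a, q, F)`. -/
def paramCoord (y : (V × Coef 2) × Coef 4) : ModelFibre := fun k =>
  (coefForm 4 y.2 : V → ℂ) (paramProj (b 0) y.1.1 (b 2 + (k : ℂ) • b 1)) -
    ((coefForm 2 y.1.2 : V → ℂ) (paramProj (b 0) y.1.1 (b 2 + (k : ℂ) • b 1)) /
      (coefForm 2 y.1.2 : V → ℂ) (paramProj (b 0) y.1.1 (b 1))) ^ 2 *
        (coefForm 4 y.2 : V → ℂ) (paramProj (b 0) y.1.1 (b 1))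

theorem fibreCoord_mkE {p : paramSet} (hp : mkX p ∈ frameSet b) (F : Coef 4) :
    fibreCoord b (mkE (p, F)).1 (mkE (p, F)).2 = paramCoord b (p.1, F) := by
  funext k
  refine (fibreCoord_mk p.2.2 (mkX_scheme p) hp _ k).trans ?_
  rw [paramCoord, ← coe_lineProj_mkX hp.1, ← coe_lineProj_mkX hp.1]
  rfl

theorem differentiableOn_paramCoord :
    DifferentiableOn ℂ (paramCoord b) {y | y.1 ∈ paramFrameSet b} := by
  have h (y : V) := differentiableOn_coefForm_paramProj (b := b)
    (s := {y : (V × Coef 2) × Coef 4 | y.1 ∈ paramFrameSet b}) (c := fun y => y.2)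
    (p := fun y => y.1) (by fun_prop) (by fun_prop) (fun _ hz => hz) y
  have h' (y : V) := differentiableOn_coefForm_paramProj (b := b)
    (s := {y : (V × Coef 2) × Coef 4 | y.1 ∈ paramFrameSet b}) (c := fun y => y.1.2)
    (p := fun y => y.1) (by fun_prop) (by fun_prop) (fun _ hz => hz) y
  refine differentiableOn_pi.2 fun k => ?_
  exact (h _).fun_sub (((differentiableOn_div (h' _) (h' _) fun z hz => hz.2).fun_pow 2).fun_mul (h _))

/-! ### A local section of the parametrization of `X` -/

variable (b) in
/-- The normalized parameters of a point of `X`: the linear equation of `L` with value `1` at `b 0`,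
and the quadratic form with value `1` at the point `framePoint b L` that restricts to an equation of
`Z` and has the point `b 0` as a double point. -/
def sectionParam (x : X) : V × Coef 2 :=
  (fun i => b.coord 0 (Pi.single i 1 - (lineProj (b 0) x.line (Pi.single i 1) : V)),
    formCoef 2 (nodeForm b 2) + ∑ k : Fin 2,
      schemeRatio x (framePoint b x.line) (frameNode b x.line k) • formCoef 2 (lagrangeForm b 2 k))

theorem linForm_sectionParam {x : X} (hx : x ∈ frameSet b) (y : V) :
    lineProj (b 0) x.line y = y - linForm (sectionParam b x).1 y • b 0 := by
  have h1 : linForm (sectionParam b x).1 =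
      b.coord 0 ∘ₗ (LinearMap.id - x.line.1.subtype ∘ₗ lineProj (b 0) x.line) := by
    refine LinearMap.pi_ext' fun i => LinearMap.ext_ring ?_
    simp [linForm_apply, sectionParam, Pi.single_apply]
  obtain ⟨c, hc⟩ := exists_coe_lineProj hx.1 y
  rw [h1]
  simp [hc]

theorem ker_linForm_sectionParam {x : X} (hx : x ∈ frameSet b) :
    LinearMap.ker (linForm (sectionParam b x).1) = x.line.1 := by
  ext y
  have h := linForm_sectionParam hx y
  rw [LinearMap.mem_ker]
  constructor
  · intro h0
    rw [h0, zero_smul, sub_zero] at h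
    rw [← h]
    exact (lineProj (b 0) x.line y).2
  · intro hy
    rw [lineProj_of_mem hx.1 hy] at h
    have h0 : linForm (sectionParam b x).1 y • b 0 = 0 := sub_eq_self.1 h.symm
    exact (smul_eq_zero.1 h0).resolve_right (b.ne_zero 0)

theorem sectionParam_fst_ne_zero {x : X} (hx : x ∈ frameSet b) : (sectionParam b x).1 ≠ 0 := by
  intro h
  apply hx.1
  rw [← ker_linForm_sectionParam hx, LinearMap.mem_ker, h, linForm_apply]
  simp

theorem coefForm_sectionParam {x : X} (hx : x ∈ frameSet b) {q : symPow x.line.1 2} (hq : q ≠ 0)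
    (h : x.scheme = Projectivization.mk ℂ q hq) :
    symRestrict x.line.1 2 (coefForm 2 (sectionParam b x).2) =
      ((q : x.line.1 → ℂ) (framePoint b x.line))⁻¹ • q := by
  have hu : (q : x.line.1 → ℂ) (framePoint b x.line) ≠ 0 := fun h' =>
    hx.2 ((memScheme_iff hq h).2 h')
  have hval (v : x.line.1) : (symRestrict x.line.1 2 (coefForm 2 (sectionParam b x).2) :
      x.line.1 → ℂ) v = (nodeForm b 2 : V → ℂ) v + ∑ k : Fin 2,
        schemeRatio x (framePoint b x.line) (frameNode b x.line k) *
          (lagrangeForm b 2 k : V → ℂ) v := by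
    change (coefForm 2 (sectionParam b x).2 : V → ℂ) v = _
    simp [sectionParam, map_add, map_smul]
  refine Subtype.ext (eq_of_apply_frame_eq (b := b) hx.1 (Subtype.prop _) (Subtype.prop _) ?_
    fun m hm => ?_)
  · rw [hval, nodeForm_apply_of_coord b (coord_framePoint_one hx.1) (coord_framePoint_two hx.1)]
    have h1 (j : Fin 2) := lagrangeForm_apply_of_coord b j (coord_framePoint_two hx.1)
    simp [h1, hu]
  · rw [hval, nodeForm_apply_of_coord' b hm (coord_frameNode_one hx.1 m)
      (coord_frameNode_two hx.1 m)]
    have h2 (j : Fin 2) := lagrangeForm_apply_of_coord' b j hm (coord_frameNode_one hx.1 m)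
      (coord_frameNode_two hx.1 m)
    simp only [h2, schemeRatio_eq hq h]
    rw [Finset.sum_eq_single ⟨m, hm⟩ (fun j _ hj => by
      rw [if_neg fun h' => hj (Fin.ext h'), mul_zero]) (by simp)]
    simp [div_eq_inv_mul]

theorem sectionParam_mem {x : X} (hx : x ∈ frameSet b) : sectionParam b x ∈ paramSet := by
  refine ⟨sectionParam_fst_ne_zero hx, ?_⟩
  have hu : (x.scheme.rep : x.line.1 → ℂ) (framePoint b x.line) ≠ 0 := fun h' =>
    hx.2 ((memScheme_iff x.scheme.rep_nonzero x.scheme.mk_rep.symm).2 h')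
  rw [ker_linForm_sectionParam hx,
    coefForm_sectionParam hx x.scheme.rep_nonzero x.scheme.mk_rep.symm]
  exact smul_ne_zero (inv_ne_zero hu) x.scheme.rep_nonzero

theorem mkX_sectionParam {x : X} (hx : x ∈ frameSet b) :
    mkX ⟨sectionParam b x, sectionParam_mem hx⟩ = x := by
  obtain ⟨L, Z⟩ := x
  induction Z using Projectivization.ind with
  | h q hq =>
    have hu : (q : L.1 → ℂ) (framePoint b L) ≠ 0 := fun h' => hx.2 ((memScheme_iff hq rfl).2 h')
    rw [mkX_eq (p := ⟨_, sectionParam_mem hx⟩) (L := L) (ker_linForm_sectionParam hx) (smul_ne_zero (inv_ne_zero hu) hq) fun v hv =>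
      congrFun (congrArg Subtype.val (coefForm_sectionParam hx hq rfl)) ⟨v, hv⟩]
    exact congrArg (X.mk L) ((Projectivization.mk_eq_mk_iff' _ _ _ _ _).2 ⟨_, rfl⟩)

theorem continuousOn_sectionParam : ContinuousOn (sectionParam b) (frameSet b) := by
  rw [isQuotientMap_mkX.continuousOn_isOpen_iff isOpen_frameSet]
  have hformula : Set.EqOn (sectionParam b ∘ mkX) ((fun p : V × Coef 2 =>
      ((fun i => b.coord 0 (Pi.single i 1 - paramProj (b 0) p.1 (Pi.single i 1)) : V),
        formCoef 2 (nodeForm b 2) + ∑ k : Fin 2,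
          ((coefForm 2 p.2 : V → ℂ) (paramProj (b 0) p.1 (b 2 + (k : ℂ) • b 1)) /
            (coefForm 2 p.2 : V → ℂ) (paramProj (b 0) p.1 (b 1))) •
              formCoef 2 (lagrangeForm b 2 k))) ∘ Subtype.val) (mkX ⁻¹' frameSet b) := by
    intro p hp
    have hp' : mkX p ∈ frameSet b := hp
    simp only [Function.comp_apply, sectionParam, schemeRatio_eq p.2.2 (mkX_scheme p)]
    simp only [← coe_lineProj_mkX hp'.1]
    rfl
  refine ContinuousOn.congr ?_ hformula
  refine ContinuousOn.comp (t := paramFrameSet b) ?_ continuous_subtype_val.continuousOn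
    fun p hp => mkX_mem_frameSet_iff.1 hp
  have h (y : V) := differentiableOn_coefForm_paramProj (b := b) (s := paramFrameSet b)
    (c := fun y => y.2) (p := fun y => y) (by fun_prop) (by fun_prop) (fun _ hz => hz) y
  refine ContinuousOn.prodMk (continuousOn_pi.2 fun i => ?_) (continuousOn_const.add
    (continuousOn_finsetSum _ fun k _ => ContinuousOn.fun_smul ?_ continuousOn_const))
  · refine (LinearMap.continuous_of_finiteDimensional (b.coord 0)).comp_continuousOn ?_
    exact continuousOn_const.sub ((differentiableOn_paramProj _).continuousOn.mono fun p hp => hp.1)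
  · exact (differentiableOn_div (h _) (h _) fun z hz => hz.2).continuousOn

/-! ### Local trivializations of `E` -/

variable (b) in
open Classical in
/-- The local section of `mkX` over `frameSet b`, with an arbitrary value elsewhere. -/
def paramSection (x : X) : paramSet :=
  if h : x ∈ frameSet b then ⟨sectionParam b x, sectionParam_mem h⟩ else (mkX_surjective x).choose

theorem paramSection_of_mem {x : X} (hx : x ∈ frameSet b) :
    paramSection b x = ⟨sectionParam b x, sectionParam_mem hx⟩ := dif_pos hx

theorem mkX_paramSection (x : X) : mkX (paramSection b x) = x := by
  by_cases hx : x ∈ frameSet b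
  · rw [paramSection_of_mem hx, mkX_sectionParam hx]
  · rw [paramSection, dif_neg hx]
    exact (mkX_surjective x).choose_spec

theorem continuousOn_paramSection : ContinuousOn (paramSection b) (frameSet b) := by
  rw [Topology.IsInducing.subtypeVal.continuousOn_iff]
  exact continuousOn_sectionParam.congr fun x hx =>
    congrArg Subtype.val (paramSection_of_mem hx)

variable (b) in
/-- The local trivialization of `E` over `frameSet b`. -/
def frameTrivialization : Trivialization ModelFibre (π ModelFibre E) where
  toFun y := (y.1, fibreCoord b y.1 y.2)
  invFun z := ⟨z.1, Submodule.Quotient.mk (symRestrict z.1.line.1 4 (interpolate b z.2))⟩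
  source := π ModelFibre E ⁻¹' frameSet b
  target := frameSet b ×ˢ Set.univ
  map_source' y hy := ⟨hy, trivial⟩
  map_target' z hz := hz.1
  left_inv' y hy := congrArg (TotalSpace.mk y.1) (mk_interpolate_fibreCoord hy y.2)
  right_inv' z hz := Prod.ext rfl (fibreCoord_interpolate hz.1 z.2)
  open_source := by
    rw [← isQuotientMap_mkE.isOpen_preimage]
    exact isOpen_frameSet.preimage (isQuotientMap_mkX.continuous.comp continuous_fst)
  open_target := isOpen_frameSet.prod isOpen_univ
  continuousOn_toFun := by
    have hopen : IsOpen (π ModelFibre E ⁻¹' frameSet b) := by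
      rw [← isQuotientMap_mkE.isOpen_preimage]
      exact isOpen_frameSet.preimage (isQuotientMap_mkX.continuous.comp continuous_fst)
    rw [isQuotientMap_mkE.continuousOn_isOpen_iff hopen]
    have hformula : Set.EqOn ((fun y : TotalSpace ModelFibre E => (y.1, fibreCoord b y.1 y.2)) ∘
        mkE) (fun y => (mkX y.1, paramCoord b (y.1.1, y.2)))
        (mkE ⁻¹' (π ModelFibre E ⁻¹' frameSet b)) :=
      fun y hy => Prod.ext rfl (fibreCoord_mkE (p := y.1) hy y.2)
    refine ContinuousOn.congr ?_ hformula
    refine (isQuotientMap_mkX.continuous.comp continuous_fst).continuousOn.prodMk ?_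
    refine differentiableOn_paramCoord.continuousOn.comp (by fun_prop) fun y hy => ?_
    exact mkX_mem_frameSet_iff.1 hy
  continuousOn_invFun := by
    have hformula : Set.EqOn (fun z : X × ModelFibre => (⟨z.1, Submodule.Quotient.mk
        (symRestrict z.1.line.1 4 (interpolate b z.2))⟩ : TotalSpace ModelFibre E))
        (mkE ∘ fun z => (paramSection b z.1, formCoef 4 (interpolate b z.2)))
        (frameSet b ×ˢ Set.univ) := by
      intro z hz
      refine (mkE_eq (mkX_paramSection z.1) fun v hv => ?_).symm
      rw [coefForm_formCoef]
      rfl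
    refine ContinuousOn.congr ?_ hformula
    refine isQuotientMap_mkE.continuous.comp_continuousOn (ContinuousOn.prodMk ?_ ?_)
    · exact continuousOn_paramSection.comp continuousOn_fst fun z hz => hz.1
    · have h := LinearMap.continuous_of_finiteDimensional (formCoef 4 ∘ₗ interpolate b)
      exact (h.comp continuous_snd).continuousOn
  baseSet := frameSet b
  open_baseSet := isOpen_frameSet
  source_eq := rfl
  target_eq := rfl
  proj_toFun _ _ := rfl

instance : (frameTrivialization b).IsLinear ℂ where
  linear x _ := (fibreCoord b x).isLinear

/-- The topology of the fibre of `E`, as a quotient of a space of functions, is the topology of the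
model fibre. -/
theorem isInducing_fibreCoord {x : X} (hx : x ∈ frameSet b) :
    Topology.IsInducing (fibreCoord b x) := by
  have hcont : Continuous (fibreCoord b x) := by
    have hq : Topology.IsQuotientMap (tautSqFibre x).mkQ := (tautSqFibre x).isQuotientMap_mkQ
    rw [hq.continuous_iff]
    refine continuous_pi fun k => ?_
    have h (p : x.line.1) : Continuous (evalForm 4 p) :=
      (continuous_apply p).comp continuous_subtype_val
    exact ((h _).const_smul _).sub ((h _).const_smul _)
  let e : E x ≃ₗ[ℂ] ModelFibre := LinearEquiv.ofBijective (fibreCoord b x)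
    ⟨fibreCoord_injective hx, fun z => ⟨_, fibreCoord_interpolate hx z⟩⟩
  have hinv : Continuous e.symm :=
    LinearMap.continuous_of_finiteDimensional e.symm.toLinearMap
  exact (Homeomorph.mk e.toEquiv hcont hinv).isInducing

end Param

theorem isInducing_totalSpaceMk (x : X) :
    Topology.IsInducing (TotalSpace.mk x : E x → TotalSpace ModelFibre E) := by
  obtain ⟨b, hx⟩ := exists_mem_frameSet x
  have hind := isInducing_fibreCoord hx
  rw [Topology.isInducing_iff_nhds]
  intro v
  have hv : TotalSpace.mk x v ∈ (frameTrivialization b).source := hx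
  have h1 := (frameTrivialization b).toOpenPartialHomeomorph.nhds_eq_comap_inf_principal hv
  rw [h1, Filter.comap_inf, Filter.comap_comap, Filter.comap_principal]
  have huniv : (TotalSpace.mk x : E x → TotalSpace ModelFibre E) ⁻¹'
      (frameTrivialization b).source = Set.univ := Set.eq_univ_of_forall fun _ => hx
  rw [huniv, Filter.principal_univ, inf_top_eq]
  have hcomp : Topology.IsInducing (fun v : E x => (x, fibreCoord b x v)) :=
    (Topology.IsInducing.of_comp (f := fun z : ModelFibre => (x, z)) (by fun_prop) continuous_snd
      Topology.IsInducing.id).comp hind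
  exact hcomp.nhds_eq_comap v

/-- The bundle `E`, with the local trivializations given by all bases of `V`. -/
@[reducible]
def fiberBundleE : FiberBundle ModelFibre E where
  totalSpaceMk_isInducing' := isInducing_totalSpaceMk
  trivializationAtlas' := Set.range frameTrivialization
  trivializationAt' x := frameTrivialization (exists_mem_frameSet x).choose
  mem_baseSet_trivializationAt' x := (exists_mem_frameSet x).choose_spec
  trivialization_mem_atlas' _ := ⟨_, rfl⟩

attribute [local instance] fiberBundleE

theorem vectorBundleE : VectorBundle ℂ ModelFibre E where
  trivialization_linear' := by
    rintro _ ⟨b, rfl⟩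
    infer_instance
  continuousOn_coordChange' := by
    rintro _ _ ⟨b, rfl⟩ ⟨b', rfl⟩
    rw [continuousOn_clm_apply]
    intro z
    have hcont : ContinuousOn (fun x : X => (frameTrivialization b'
        ((frameTrivialization b).toOpenPartialHomeomorph.symm (x, z))).2)
        (frameSet b ∩ frameSet b') := by
      refine continuous_snd.comp_continuousOn
        ((frameTrivialization b').continuousOn_toFun.comp (t := (frameTrivialization b').source)
          ((frameTrivialization b).continuousOn_invFun.comp (by fun_prop) ?_) ?_)
      · exact fun x hx => ⟨hx.1, trivial⟩
      · exact fun x hx => hx.2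
    exact hcont.congr fun x hx => Trivialization.coordChangeL_apply' _ _ hx z

theorem isHolomorphicTrivialization_frameTrivialization (b : Module.Basis (Fin 3) ℂ V) :
    IsHolomorphicTrivialization (frameTrivialization b) := by
  refine ⟨paramCoord b, differentiableOn_paramCoord.mono ?_, fun p F hp =>
    (fibreCoord_mkE hp F).symm⟩
  rintro y ⟨_, hy⟩
  exact mkX_mem_frameSet_iff.1 hy

namespace PlaneQuartic

variable (C : PlaneQuartic)

theorem mk_inducedSection_mkX (p : paramSet) :
    (⟨mkX p, C.inducedSection (mkX p)⟩ : TotalSpace ModelFibre E) =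
      mkE (p, formCoef 4 C.toSym) := by
  refine (mkE_eq rfl fun v hv => ?_).symm
  rw [coefForm_formCoef]
  rfl

theorem continuous_inducedSection :
    Continuous (fun x : X => (⟨x, C.inducedSection x⟩ : TotalSpace ModelFibre E)) := by
  rw [isQuotientMap_mkX.continuous_iff]
  have h : (fun x : X => (⟨x, C.inducedSection x⟩ : TotalSpace ModelFibre E)) ∘ mkX =
      mkE ∘ fun p => (p, formCoef 4 C.toSym) := funext C.mk_inducedSection_mkX
  rw [h]
  exact isQuotientMap_mkE.continuous.comp (by fun_prop)

theorem isHolomorphicSectionIn_frameTrivialization (b : Module.Basis (Fin 3) ℂ V) :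
    IsHolomorphicSectionIn (frameTrivialization b) C.inducedSection := by
  refine ⟨fun p => paramCoord b (p, formCoef 4 C.toSym), ?_, fun p hp => ?_⟩
  · refine differentiableOn_paramCoord.comp (by fun_prop) ?_
    rintro y ⟨_, hy⟩
    exact mkX_mem_frameSet_iff.1 hy
  · rw [mk_inducedSection_mkX]
    exact (fibreCoord_mkE hp _).symm

end PlaneQuartic

end QuarticBitangents

end

theorem theorem3p1 (G : Subgroup PGL(3, ℂ))
    (hG : ∃ C₀ : PlaneQuartic, C₀.IsSmooth ∧ G ≤ C₀.aut) :
    -- `E` is a holomorphic vector bundle of rank four over `X`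
    ∃ _ : FiberBundle ModelFibre E,
      VectorBundle ℂ ModelFibre E ∧
      (∀ e ∈ FiberBundle.trivializationAtlas ModelFibre E, IsHolomorphicTrivialization e) ∧
      -- on which `G` acts, compatibly with its action on the tautological bundle,
      ∃ ρ : LinearizedAction G ModelFibre E, IsNatural ρ ∧ ρ.IsContinuous ∧
        ∀ C : PlaneQuartic, G ≤ C.aut →
          -- and every `G`-invariant quartic induces a holomorphic section of `E`,
          Continuous (fun x : X => (⟨x, C.inducedSection x⟩ : TotalSpace ModelFibre E)) ∧
          (∀ e ∈ FiberBundle.trivializationAtlas ModelFibre E,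
            IsHolomorphicSectionIn e C.inducedSection) ∧
          -- which is equivariant when the scalars in the action of `G` are normalised suitably,
          (∃ χ : G →* ℂˣ, IsNatural (ρ.twist χ) ∧ (ρ.twist χ).IsContinuous ∧
            (ρ.twist χ).IsEquivariantSection C.inducedSection) ∧
          -- and whose zeros are the bitangents of `C` together with their contact points, if `C`
          -- is smooth or, more generally, contains no line
          (C.IsSmooth → C.ContainsNoLine) ∧
          (C.ContainsNoLine →
            Set.BijOn X.line {x | C.inducedSection x = 0} {L | C.IsBitangent L} ∧
            ∀ x : X, C.inducedSection x = 0 → ∀ p : x.line.1, p ≠ 0 →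
              (MemScheme x p ↔ C.ContactAtLeast x.line p 2)) := by
  obtain ⟨C₀, -, hC₀⟩ := hG
  obtain ⟨ρ, hρ, hχ⟩ := C₀.exists_natural_action hC₀
  refine ⟨fiberBundleE, vectorBundleE, ?_, ρ, hρ, hρ.isContinuous, fun C hC =>
    ⟨C.continuous_inducedSection, ?_, ?_, fun h => h.containsNoLine,
      fun h => ⟨PlaneQuartic.bijOn_line h, PlaneQuartic.memScheme_iff_contactAtLeast h⟩⟩⟩
  · rintro _ ⟨b, rfl⟩
    exact isHolomorphicTrivialization_frameTrivialization b
  · rintro _ ⟨b, rfl⟩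
    exact C.isHolomorphicSectionIn_frameTrivialization b
  · obtain ⟨χ, h⟩ := hχ C hC
    exact ⟨χ, hρ.twist χ, (hρ.twist χ).isContinuous, h⟩
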